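/- All alphabets below are finite. Let $(S_1,S_2)$ be a discrete memoryless source with joint law $p(s_1,s_2)$ on $\mathcal S_1\times\mathcal S_2$, let $p(y|x_1,x_2)$ be a discrete memoryless multiple access channel with inputs in $\mathcal X_1,\mathcal X_2$ and output in $\mathcal Y$, and let $d_j:\mathcal S_j\times\hat{\mathcal S}_j\to\mathbb R$, $j=1,2$, be distortion measures. A pair $(D_1,D_2)$ of real numbers is \emph{achievable} if for every $\epsilon>0$ and all sufficiently large $n$ there are encoders $e_j:\mathcal S_j^n\to\mathcal X_j^n$ and decoders $g_j:\mathcal Y^n\to\hat{\mathcal S}_j^n$, $j=1,2$, such that, when $X_j^n=e_j(S_j^n)$ is sent over the channel and $\hat S_j^n=g_j(Y^n)$, $$\frac1n\sum_{i=1}^n\mathbb E[d_j(S_{ji},\hat S_{ji})]\le D_j+\epsilon,\qquad j=1,2 .$$ For a random variable $Z$ jointly distributed with $(S_1,S_2)$ let $$R_{S_j|Z}(D)=\inf\{\,I(S_j;U|Z)\;:\;p(u|s_j,z),\ \min_{f}\mathbb E[d_j(S_j,f(U,Z))]\le D\,\},$$ where $U$ ranges over random variables with finite alphabet and $f$ over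 functions with values in $\hat{\mathcal S}_j$, and let $$R_{S_1S_2}(D_1,D_2)=\inf\{\,I(S_1,S_2;\hat S_1,\hat S_2)\;:\;p(\hat s_1,\hat s_2|s_1,s_2),\ \mathbb E[d_j(S_j,\hat S_j)]\le D_j,\ j=1,2\,\}$$ (an infimum over the empty set is $+\infty$). If $(D_1,D_2)$ is achievable, then for every $Z$ (with finite alphabet) such that $S_1-Z-S_2$ is a Markov chain there are random variables $X_1,X_2,Y,Q$, with $Q$ finite-valued and joint law $p(q)\,p(x_1|q)\,p(x_2|q)\,p(y|x_1,x_2)$ (so that $X_1-Q-X_2$ is a Markov chain), for which both $$R_{S_1|Z}(D_1)+R_{S_2|Z}(D_2)\le I(X_1,X_2;Y|Q)\qquad\text{and}\qquad R_{S_1S_2}(D_1,D_2)\le I(X_1,X_2;Y).$$ -/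

import Mathlib

open Filter

namespace MAC

noncomputable section

/-! ### Random variables on a discrete probability space -/

/-- `P(X = a)`. -/
def prob {Ω A : Type*} (P : PMF Ω) (X : Ω → A) (a : A) : ℝ := (P.map X a).toReal

/-- `E[f]` on a finite probability space. -/
def expect {Ω : Type*} [Fintype Ω] (P : PMF Ω) (f : Ω → ℝ) : ℝ := ∑ ω, (P ω).toReal * f ω

/-- Shannon entropy `H(X)` (natural logarithm). -/
def entropy {Ω A : Type*} [Fintype A] (P : PMF Ω) (X : Ω → A) : ℝ :=
  -∑ a, prob P X a * Real.log (prob P X a)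

/-- Conditional entropy `H(X | Z) = -∑ p(a,c) log p(a|c)`. -/
def condEntropy {Ω A C : Type*} [Fintype A] [Fintype C] (P : PMF Ω) (X : Ω → A) (Z : Ω → C) : ℝ :=
  -∑ a, ∑ c, prob P (fun ω => (X ω, Z ω)) (a, c) *
    Real.log (prob P (fun ω => (X ω, Z ω)) (a, c) / prob P Z c)

/-- Mutual information `I(X; Y) = H(X) - H(X | Y)`. -/
def mutualInfo {Ω A B : Type*} [Fintype A] [Fintype B] (P : PMF Ω) (X : Ω → A) (Y : Ω → B) : ℝ :=
  entropy P X - condEntropy P X Y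

/-- Conditional mutual information `I(X; Y | Z) = H(X | Z) - H(X | Y, Z)`. -/
def condMutualInfo {Ω A B C : Type*} [Fintype A] [Fintype B] [Fintype C]
    (P : PMF Ω) (X : Ω → A) (Y : Ω → B) (Z : Ω → C) : ℝ :=
  condEntropy P X Z - condEntropy P X (fun ω => (Y ω, Z ω))

/-- The Markov chain `X – Z – Y`: `p(x,z,y) p(z) = p(x,z) p(z,y)`, that is, `X` and `Y` are
conditionally independent given `Z`. -/
def IsMarkovChain {Ω A B C : Type*} (P : PMF Ω) (X : Ω → A) (Z : Ω → C) (Y : Ω → B) : Prop :=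
  ∀ x z y, prob P (fun ω => (X ω, Z ω, Y ω)) (x, z, y) * prob P Z z =
    prob P (fun ω => (X ω, Z ω)) (x, z) * prob P (fun ω => (Z ω, Y ω)) (z, y)

/-- The joint law `p(a) κ(b | a)` of an input with law `p` and the output of the stochastic
map `κ`. -/
def joint {A B : Type*} (p : PMF A) (κ : A → PMF B) : PMF (A × B) :=
  p.bind fun a => (κ a).map fun b => (a, b)

/-! ### Rate-distortion functions

They are `⊤` when the distortion constraints cannot be met. -/

/-- The minimum average distortion `ℰ(S | V) = min_f E[d(S, f(V))]`. -/
def minDistortion {Ω A A' B : Type*} [Fintype Ω] (P : PMF Ω) (d : A → A' → ℝ)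
    (S : Ω → A) (V : Ω → B) : EReal :=
  ⨅ f : B → A', ((expect P fun ω => d (S ω) (f (V ω)) : ℝ) : EReal)

/-- The conditional rate-distortion function `R_{S|Z}(D)`, for `(S, Z)` of law `p`: the infimum of
`I(S; U | Z)` over all `p(u | s, z)`, with `U` in any finite alphabet, such that
`ℰ(S | U, Z) ≤ D`. -/
def condRateDistortion {A A' C : Type*} [Fintype A] [Fintype C] (p : PMF (A × C))
    (d : A → A' → ℝ) (D : ℝ) : EReal :=
  ⨅ (k : ℕ) (κ : A × C → PMF (Fin k))
    (_ : minDistortion (joint p κ) d (fun ω => ω.1.1) (fun ω => (ω.2, ω.1.2)) ≤ (D : EReal)),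
    ((condMutualInfo (joint p κ) (fun ω => ω.1.1) (fun ω => ω.2) (fun ω => ω.1.2) : ℝ) : EReal)

/-- The joint rate-distortion function `R_{S₁S₂}(D₁, D₂)`, for `(S₁, S₂)` of law `p`: the infimum of
`I(S₁, S₂; Ŝ₁, Ŝ₂)` over all `p(ŝ₁, ŝ₂ | s₁, s₂)` with `E[dⱼ(Sⱼ, Ŝⱼ)] ≤ Dⱼ` for `j = 1, 2`. -/
def jointRateDistortion {S₁ S₂ R₁ R₂ : Type*} [Fintype S₁] [Fintype S₂] [Fintype R₁] [Fintype R₂]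
    (p : PMF (S₁ × S₂)) (d₁ : S₁ → R₁ → ℝ) (d₂ : S₂ → R₂ → ℝ) (D₁ D₂ : ℝ) : EReal :=
  ⨅ (κ : S₁ × S₂ → PMF (R₁ × R₂))
    (_ : expect (joint p κ) (fun ω => d₁ ω.1.1 ω.2.1) ≤ D₁)
    (_ : expect (joint p κ) (fun ω => d₂ ω.1.2 ω.2.2) ≤ D₂),
    ((mutualInfo (joint p κ) (fun ω => ω.1) (fun ω => ω.2) : ℝ) : EReal)

/-! ### Codes for a pair of sources over a multiple access channel -/

/-- A code of block length `n`: encoder `j` maps `Sⱼⁿ` to `Xⱼⁿ`, and the decoder maps `Yⁿ` to the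
reconstructions `Ŝ₁ⁿ` and `Ŝ₂ⁿ`. There is no side information. -/
structure Code (S₁ S₂ X₁ X₂ Y R₁ R₂ : Type*) (n : ℕ) where
  enc₁ : (Fin n → S₁) → (Fin n → X₁)
  enc₂ : (Fin n → S₂) → (Fin n → X₂)
  dec₁ : (Fin n → Y) → (Fin n → R₁)
  dec₂ : (Fin n → Y) → (Fin n → R₂)

section Code

variable {S₁ S₂ X₁ X₂ Y R₁ R₂ : Type*} {n : ℕ}

/-- The probability `p(s₁ⁿ, s₂ⁿ, yⁿ)` of a source block and a channel output, for a memoryless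
source of law `p` and a memoryless channel `W`. -/
def blockProb (p : PMF (S₁ × S₂)) (W : X₁ → X₂ → PMF Y) (c : Code S₁ S₂ X₁ X₂ Y R₁ R₂ n)
    (s₁ : Fin n → S₁) (s₂ : Fin n → S₂) (y : Fin n → Y) : ℝ :=
  (∏ i, (p (s₁ i, s₂ i)).toReal) * ∏ i, (W (c.enc₁ s₁ i) (c.enc₂ s₂ i) (y i)).toReal

/-- `(1/n) ∑ᵢ E[d₁(S₁ᵢ, Ŝ₁ᵢ)]`. -/
def distortion₁ [Fintype S₁] [Fintype S₂] [Fintype Y] (p : PMF (S₁ × S₂)) (W : X₁ → X₂ → PMF Y)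
    (c : Code S₁ S₂ X₁ X₂ Y R₁ R₂ n) (d₁ : S₁ → R₁ → ℝ) : ℝ :=
  (1 / (n : ℝ)) * ∑ i, ∑ s₁, ∑ s₂, ∑ y, blockProb p W c s₁ s₂ y * d₁ (s₁ i) (c.dec₁ y i)

/-- `(1/n) ∑ᵢ E[d₂(S₂ᵢ, Ŝ₂ᵢ)]`. -/
def distortion₂ [Fintype S₁] [Fintype S₂] [Fintype Y] (p : PMF (S₁ × S₂)) (W : X₁ → X₂ → PMF Y)
    (c : Code S₁ S₂ X₁ X₂ Y R₁ R₂ n) (d₂ : S₂ → R₂ → ℝ) : ℝ :=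
  (1 / (n : ℝ)) * ∑ i, ∑ s₁, ∑ s₂, ∑ y, blockProb p W c s₁ s₂ y * d₂ (s₂ i) (c.dec₂ y i)

/-- `(D₁, D₂)` is achievable: there are codes of all large block lengths `n` whose average
distortions are at most `Dⱼ + εₙ`, with `εₙ → 0`. -/
def Achievable [Fintype S₁] [Fintype S₂] [Fintype Y] (p : PMF (S₁ × S₂)) (W : X₁ → X₂ → PMF Y)
    (d₁ : S₁ → R₁ → ℝ) (d₂ : S₂ → R₂ → ℝ) (D₁ D₂ : ℝ) : Prop :=
  ∀ ε : ℝ, 0 < ε → ∀ᶠ n in atTop, ∃ c : Code S₁ S₂ X₁ X₂ Y R₁ R₂ n,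
    distortion₁ p W c d₁ ≤ D₁ + ε ∧ distortion₂ p W c d₂ ≤ D₂ + ε

end Code

end

end MAC

/-! The law of (S₁, S₂, Z) factors as m(z) k₁(s₁|z) k₂(s₂|z), so a block code may be accompanied by
an i.i.d. block Zⁿ given which S₁ⁿ and S₂ⁿ are independent. Independence gives I(S₁ⁿ;Yⁿ|Zⁿ) +
I(S₂ⁿ;Yⁿ|Zⁿ) ≤ I(S₁ⁿ,S₂ⁿ;Yⁿ|Zⁿ) (`condInfo_add_le`). Let I be a uniform time index and Q = (Zⁿ, I).
Memoryless terms are bounded below by their letters at time I (`le_cent_block`), the others above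
(`cent_block_le`), which yields the conditional bound (`block_cond_info_le`). Each encoder sees only
its own source, so X₁–Q–X₂ holds (`marg_timeShare_channel`). The same argument without conditioning
on Z gives the joint bound for the same inputs (`block_info_le`). The entropy inequalities all rest
on Gibbs' inequality `cent_le_cross`, with the competing kernel chosen to suit.

A code reaches only Dⱼ + ε, and the alphabet of Q grows with n. Carathéodory's theorem replaces Q by
a variable of fixed size without changing the input law or H(Y|Q) (`exists_fin_share`). The
single-letter laws satisfying both inequalities then form a compact set (`isCompact_feasible`) on
which the largest excess distortion attains its minimum. That minimum is at most every ε > 0, so the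
constraints hold exactly at (D₁, D₂), and no continuity of the rate-distortion functions is needed.
-/

namespace MAC

open Real

/-! ### Laws and entropies for weights on a finite set -/

section Weights

variable {Ω A B C : Type*} [Fintype Ω] [Fintype A] [Fintype B] [Fintype C]

open Classical in
/-- The law of `X` under the weights `w`. -/
noncomputable def marg {Ω A : Type*} [Fintype Ω] (w : Ω → ℝ) (X : Ω → A) (a : A) : ℝ :=
  ∑ ω, if X ω = a then w ω else 0

/-- The entropy of `X` under the weights `w`. -/
noncomputable def ent {Ω A : Type*} [Fintype Ω] [Fintype A] (w : Ω → ℝ) (X : Ω → A) : ℝ :=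
  ∑ a, negMulLog (marg w X a)

/-- The conditional entropy of `X` given `Z` under the weights `w`. -/
noncomputable def cent {Ω A C : Type*} [Fintype Ω] [Fintype A] [Fintype C]
    (w : Ω → ℝ) (X : Ω → A) (Z : Ω → C) : ℝ :=
  ent w (fun ω => (X ω, Z ω)) - ent w Z

theorem marg_nonneg {A : Type*} {w : Ω → ℝ} (hw : ∀ ω, 0 ≤ w ω) (X : Ω → A) (a : A) :
    0 ≤ marg w X a := by
  classical
  exact Finset.sum_nonneg fun ω _ => by split_ifs <;> simp [hw]

theorem marg_pos {A : Type*} {w : Ω → ℝ} (hw : ∀ ω, 0 ≤ w ω) (X : Ω → A) {ω : Ω} (h : 0 < w ω) :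
    0 < marg w X (X ω) := by
  classical
  refine Finset.sum_pos' (fun ω _ => by split_ifs <;> simp [hw]) ⟨ω, Finset.mem_univ _, by simpa⟩

theorem sum_marg_mul (w : Ω → ℝ) (X : Ω → A) (g : A → ℝ) :
    ∑ a, marg w X a * g a = ∑ ω, w ω * g (X ω) := by
  classical
  simp only [marg, Finset.sum_mul, ite_mul, zero_mul]
  rw [Finset.sum_comm]
  simp

theorem sum_marg (w : Ω → ℝ) (X : Ω → A) : ∑ a, marg w X a = ∑ ω, w ω := by
  simpa using sum_marg_mul w X fun _ => 1

theorem marg_id (w : Ω → ℝ) : marg w (fun ω => ω) = w := by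
  classical
  ext a
  simp [marg]

theorem marg_marg {B : Type*} (w : Ω → ℝ) (X : Ω → A) (f : A → B) (b : B) :
    marg (marg w X) f b = marg w (fun ω => f (X ω)) b := by
  classical
  have := sum_marg_mul w X fun a => if f a = b then 1 else 0
  simpa [marg] using this

theorem marg_comp_injective {A B : Type*} (w : Ω → ℝ) (X : Ω → A) {e : A → B}
    (he : Function.Injective e) (a : A) : marg w (fun ω => e (X ω)) (e a) = marg w X a := by
  classical
  simp [marg, he.eq_iff]

theorem sum_marg_prod {C : Type*} (w : Ω → ℝ) (X : Ω → A) (Z : Ω → C) (c : C) :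
    ∑ a, marg w (fun ω => (X ω, Z ω)) (a, c) = marg w Z c := by
  classical
  simp only [marg]
  rw [Finset.sum_comm]
  refine Finset.sum_congr rfl fun ω _ => ?_
  simp only [Prod.mk.injEq]
  by_cases h : Z ω = c <;> simp [h]

theorem marg_fst (w : A × B → ℝ) (a : A) : marg w (fun ω => ω.1) a = ∑ b, w (a, b) := by
  classical
  simp only [marg, Fintype.sum_prod_type]
  rw [Finset.sum_comm]
  simp

theorem ent_marg (w : Ω → ℝ) (X : Ω → A) (f : A → B) :
    ent (marg w X) f = ent w (fun ω => f (X ω)) := by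
  simp only [ent, marg_marg]

theorem cent_marg (w : Ω → ℝ) (X : Ω → A) (f : A → B) (g : A → C) :
    cent (marg w X) f g = cent w (fun ω => f (X ω)) (fun ω => g (X ω)) := by
  simp only [cent, ent_marg]

theorem ent_eq (w : Ω → ℝ) (X : Ω → A) : ent w X = -∑ ω, w ω * log (marg w X (X ω)) := by
  rw [← sum_marg_mul w X fun a => log (marg w X a), ent, ← Finset.sum_neg_distrib]
  simp [negMulLog]

theorem ent_comp_injective (w : Ω → ℝ) (X : Ω → A) {e : A → B} (he : Function.Injective e) :
    ent w (fun ω => e (X ω)) = ent w X := by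
  simp only [ent_eq, marg_comp_injective w X he]

theorem cent_eq (w : Ω → ℝ) (X : Ω → A) (Z : Ω → C) :
    cent w X Z = -∑ ω, w ω *
      (log (marg w (fun ω => (X ω, Z ω)) (X ω, Z ω)) - log (marg w Z (Z ω))) := by
  simp only [cent, ent_eq, mul_sub, Finset.sum_sub_distrib]
  ring

/-- **Gibbs' inequality**: the conditional entropy is at most the cross entropy relative to any
substochastic kernel. -/
theorem cent_le_cross {w : Ω → ℝ} (hw : ∀ ω, 0 ≤ w ω) (X : Ω → A) (Z : Ω → C)
    {q : A → C → ℝ} (hq : ∀ a c, 0 ≤ q a c) (hq1 : ∀ c, ∑ a, q a c ≤ 1)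
    (hpos : ∀ ω, 0 < w ω → 0 < q (X ω) (Z ω)) :
    cent w X Z ≤ -∑ ω, w ω * log (q (X ω) (Z ω)) := by
  set m := marg w (fun ω => (X ω, Z ω)) with hm
  -- This is log x ≤ x - 1 at x = q(a|c) P(c) / P(a,c), weighted by `w ω`. After summation the right
  -- side is nonpositive because `q` is substochastic.
  have hterm : ∀ ω, w ω * log (q (X ω) (Z ω)) - w ω * (log (m (X ω, Z ω)) - log (marg w Z (Z ω)))
      ≤ w ω * (q (X ω) (Z ω) * marg w Z (Z ω) / m (X ω, Z ω)) - w ω := by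
    intro ω
    rcases (hw ω).eq_or_lt with h | h
    · simp [← h]
    · have h1 := hpos ω h
      have h2 : 0 < m (X ω, Z ω) := marg_pos hw (fun ω => (X ω, Z ω)) h
      have h3 := marg_pos hw Z h
      have h4 := log_le_sub_one_of_pos (div_pos (mul_pos h1 h3) h2)
      rw [log_div (mul_pos h1 h3).ne' h2.ne', log_mul h1.ne' h3.ne'] at h4
      nlinarith
  have hsum := Finset.sum_le_sum fun ω (_ : ω ∈ Finset.univ) => hterm ω
  simp only [Finset.sum_sub_distrib] at hsum
  have h1 : ∑ ω, w ω * (q (X ω) (Z ω) * marg w Z (Z ω) / m (X ω, Z ω)) ≤ ∑ ω, w ω := by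
    rw [← sum_marg_mul w (fun ω => (X ω, Z ω)) fun x => q x.1 x.2 * marg w Z x.2 / m x]
    calc _ ≤ ∑ x : A × C, q x.1 x.2 * marg w Z x.2 := by
          refine Finset.sum_le_sum fun x _ => ?_
          have h0 : 0 ≤ q x.1 x.2 * marg w Z x.2 := mul_nonneg (hq _ _) (marg_nonneg hw _ _)
          rcases eq_or_ne (m x) 0 with h | h
          · rw [← hm, h]; simpa using h0
          · rw [← hm, mul_div_cancel₀ _ h]
      _ = ∑ c, (∑ a, q a c) * marg w Z c := by
          rw [Fintype.sum_prod_type_right]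
          simp [Finset.sum_mul]
      _ ≤ ∑ c, marg w Z c := Finset.sum_le_sum fun c _ =>
          mul_le_of_le_one_left (marg_nonneg hw _ _) (hq1 c)
      _ = _ := sum_marg w Z
  rw [cent_eq]
  linarith

/-- The conditional entropy in terms of a version `q` of the conditional law. -/
theorem cent_eq_cross {w : Ω → ℝ} (hw : ∀ ω, 0 ≤ w ω) (X : Ω → A) (Z : Ω → C) {q : A → C → ℝ}
    (h : ∀ a c, marg w (fun ω => (X ω, Z ω)) (a, c) = q a c * marg w Z c) :
    cent w X Z = -∑ ω, w ω * log (q (X ω) (Z ω)) := by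
  rw [cent_eq]
  congr 1
  refine Finset.sum_congr rfl fun ω _ => ?_
  rcases (hw ω).eq_or_lt with h0 | h0
  · simp [← h0]
  · have h1 := marg_pos hw (fun ω => (X ω, Z ω)) h0
    have h3 := marg_pos hw Z h0
    rw [h] at h1 ⊢
    have h2 : q (X ω) (Z ω) ≠ 0 := by rintro h; simp [h] at h1
    rw [log_mul h2 h3.ne']
    ring

/-- The conditional law of `X` given `Z`, zero where `Z` has no mass. -/
noncomputable def condLaw {Ω A C : Type*} [Fintype Ω] (w : Ω → ℝ) (X : Ω → A) (Z : Ω → C)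
    (a : A) (c : C) : ℝ :=
  marg w (fun ω => (X ω, Z ω)) (a, c) / marg w Z c

theorem condLaw_nonneg {A C : Type*} {w : Ω → ℝ} (hw : ∀ ω, 0 ≤ w ω) (X : Ω → A) (Z : Ω → C)
    (a : A) (c : C) : 0 ≤ condLaw w X Z a c :=
  div_nonneg (marg_nonneg hw _ _) (marg_nonneg hw _ _)

/-- The sum is 0 where `Z` has no mass, which is why Gibbs' inequality is stated for substochastic
kernels. -/
theorem sum_condLaw_le {C : Type*} (w : Ω → ℝ) (X : Ω → A) (Z : Ω → C) (c : C) :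
    ∑ a, condLaw w X Z a c ≤ 1 := by
  simp only [condLaw, ← Finset.sum_div, sum_marg_prod]
  exact div_self_le_one _

theorem condLaw_pos {A C : Type*} {w : Ω → ℝ} (hw : ∀ ω, 0 ≤ w ω) (X : Ω → A) (Z : Ω → C) {ω : Ω}
    (h : 0 < w ω) : 0 < condLaw w X Z (X ω) (Z ω) :=
  div_pos (marg_pos hw (fun ω => (X ω, Z ω)) h) (marg_pos hw Z h)

/-- Division by zero is harmless: where `Z` has no mass, the joint masses are nonnegative with sum
zero. -/
theorem marg_prod_eq_condLaw_mul {C : Type*} {w : Ω → ℝ} (hw : ∀ ω, 0 ≤ w ω) (X : Ω → A)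
    (Z : Ω → C) (a : A) (c : C) :
    marg w (fun ω => (X ω, Z ω)) (a, c) = condLaw w X Z a c * marg w Z c := by
  rcases eq_or_ne (marg w Z c) 0 with h | h
  · rw [h, mul_zero]
    have h1 := sum_marg_prod w X Z c
    rw [h, Finset.sum_eq_zero_iff_of_nonneg fun _ _ => marg_nonneg hw _ _] at h1
    exact h1 a (Finset.mem_univ _)
  · rw [condLaw, div_mul_cancel₀ _ h]

theorem cent_eq_condLaw {w : Ω → ℝ} (hw : ∀ ω, 0 ≤ w ω) (X : Ω → A) (Z : Ω → C) :
    cent w X Z = -∑ ω, w ω * log (condLaw w X Z (X ω) (Z ω)) :=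
  cent_eq_cross hw X Z (marg_prod_eq_condLaw_mul hw X Z)

/-- Conditioning on more reduces the entropy. -/
theorem cent_le_cent_comp {w : Ω → ℝ} (hw : ∀ ω, 0 ≤ w ω) (X : Ω → A) (Z : Ω → C) (f : C → B) :
    cent w X Z ≤ cent w X (fun ω => f (Z ω)) := by
  rw [cent_eq_condLaw hw X fun ω => f (Z ω)]
  -- The competitor in Gibbs' inequality is the conditional law given the coarser variable.
  exact cent_le_cross hw X Z (q := fun a c => condLaw w X (fun ω => f (Z ω)) a (f c))
    (fun _ _ => condLaw_nonneg hw _ _ _ _) (fun _ => sum_condLaw_le _ _ _ _)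
    (fun ω h => condLaw_pos hw X (fun ω => f (Z ω)) h)

/-- Conditionally independent variables: the conditional entropies add up. -/
theorem cent_add_cent_le {w : Ω → ℝ} (hw : ∀ ω, 0 ≤ w ω) (X : Ω → A) (Y : Ω → B) (Z : Ω → C)
    {q₁ : A → C → ℝ} {q₂ : B → C → ℝ} (hq₁ : ∀ a c, 0 ≤ q₁ a c) (hq₂ : ∀ b c, 0 ≤ q₂ b c)
    (hs₁ : ∀ c, ∑ a, q₁ a c ≤ 1) (hs₂ : ∀ c, ∑ b, q₂ b c ≤ 1)
    (h : ∀ a b c, marg w (fun ω => ((X ω, Y ω), Z ω)) ((a, b), c) = q₁ a c * q₂ b c * marg w Z c) :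
    cent w X Z + cent w Y Z ≤ cent w (fun ω => (X ω, Y ω)) Z := by
  have hpos : ∀ ω, 0 < w ω → 0 < q₁ (X ω) (Z ω) ∧ 0 < q₂ (Y ω) (Z ω) := by
    intro ω h0
    have h1 := marg_pos hw (fun ω => ((X ω, Y ω), Z ω)) h0
    rw [h] at h1
    constructor
    · refine (hq₁ _ _).lt_of_ne fun h => ?_
      simp [← h] at h1
    · refine (hq₂ _ _).lt_of_ne fun h => ?_
      simp [← h] at h1
  -- H(X,Y|Z) is exactly the cross entropy of the product kernel. Its logarithm splits, and Gibbs'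
  -- inequality applies to each half.
  have e := cent_eq_cross hw (fun ω => (X ω, Y ω)) Z (q := fun x c => q₁ x.1 c * q₂ x.2 c)
    fun x c => h x.1 x.2 c
  have l₁ := cent_le_cross hw X Z hq₁ hs₁ fun ω h => (hpos ω h).1
  have l₂ := cent_le_cross hw Y Z hq₂ hs₂ fun ω h => (hpos ω h).2
  have e' : ∑ ω, w ω * log (q₁ (X ω) (Z ω) * q₂ (Y ω) (Z ω)) =
      ∑ ω, w ω * log (q₁ (X ω) (Z ω)) + ∑ ω, w ω * log (q₂ (Y ω) (Z ω)) := by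
    rw [← Finset.sum_add_distrib]
    refine Finset.sum_congr rfl fun ω _ => ?_
    rcases (hw ω).eq_or_lt with h0 | h0
    · simp [← h0]
    · rw [log_mul (hpos ω h0).1.ne' (hpos ω h0).2.ne']
      ring
  linarith

/-- Two conditionally independent sources convey no more about `Y` than their pair does. -/
theorem condInfo_add_le {D : Type*} [Fintype D] {w : Ω → ℝ} (hw : ∀ ω, 0 ≤ w ω) (X₁ : Ω → A)
    (X₂ : Ω → B) (Y : Ω → D) (Z : Ω → C)
    (h : cent w X₁ Z + cent w X₂ Z ≤ cent w (fun ω => (X₁ ω, X₂ ω)) Z) :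
    cent w X₁ Z - cent w X₁ (fun ω => (Y ω, Z ω)) +
        (cent w X₂ Z - cent w X₂ (fun ω => (Y ω, Z ω))) ≤
      cent w Y Z - cent w Y (fun ω => (Z ω, X₁ ω, X₂ ω)) := by
  -- H(X₂|X₁,Y,Z) ≤ H(X₂|Y,Z); with `h` and the chain rule the left side is at most I(X₁,X₂;Y|Z).
  -- The equalities below only reorder tuples.
  have h1 := cent_le_cent_comp hw X₂ (fun ω => (X₁ ω, Y ω, Z ω)) fun x => x.2
  have e1 : ent w (fun ω => ((X₁ ω, X₂ ω), Z ω)) = ent w (fun ω => (Z ω, X₁ ω, X₂ ω)) :=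
    ent_comp_injective w (fun ω => (Z ω, X₁ ω, X₂ ω)) (e := fun x => ((x.2.1, x.2.2), x.1))
      fun x y h => by simp only [Prod.mk.injEq] at h; ext <;> simp [h]
  have e2 : ent w (fun ω => (X₂ ω, X₁ ω, Y ω, Z ω)) = ent w (fun ω => (Y ω, Z ω, X₁ ω, X₂ ω)) :=
    ent_comp_injective w (fun ω => (Y ω, Z ω, X₁ ω, X₂ ω))
      (e := fun x => (x.2.2.2, x.2.2.1, x.1, x.2.1))
      fun x y h => by simp only [Prod.mk.injEq] at h; ext <;> simp [h]
  simp only [cent] at h h1 ⊢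
  linarith

theorem ent_sub_cent_comm (w : Ω → ℝ) (X : Ω → A) (Y : Ω → B) :
    ent w X - cent w X Y = ent w Y - cent w Y X := by
  have e : ent w (fun ω => (X ω, Y ω)) = ent w (fun ω => (Y ω, X ω)) :=
    ent_comp_injective w (fun ω => (Y ω, X ω)) Prod.swap_injective
  simp only [cent, e]
  ring

theorem cent_sub_cent_comm (w : Ω → ℝ) (X : Ω → A) (Y : Ω → B) (Z : Ω → C) :
    cent w X Z - cent w X (fun ω => (Y ω, Z ω)) = cent w Y Z - cent w Y (fun ω => (X ω, Z ω)) := by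
  have e : ent w (fun ω => (X ω, Y ω, Z ω)) = ent w (fun ω => (Y ω, X ω, Z ω)) :=
    ent_comp_injective w (fun ω => (Y ω, X ω, Z ω)) (e := fun x => (x.2.1, x.1, x.2.2))
      fun x y h => by simp only [Prod.mk.injEq] at h; ext <;> simp [h]
  simp only [cent, e]
  ring

theorem cent_unit {w : Ω → ℝ} (hw : ∑ ω, w ω = 1) (X : Ω → A) :
    cent w X (fun _ => ()) = ent w X := by
  have e : ent w (fun ω => (X ω, ())) = ent w X :=
    ent_comp_injective w X (e := fun x => (x, ())) fun x y h => by simpa using h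
  have e' : ent w (fun _ => ()) = 0 := by simp [ent, marg, hw]
  simp [cent, e, e']

/-- Testing against indicators determines a law, so that laws can be identified below by
interchanging sums. -/
theorem marg_eq_of_forall {w : Ω → ℝ} {X : Ω → A} {v : A → ℝ}
    (h : ∀ g : A → ℝ, ∑ ω, w ω * g (X ω) = ∑ a, v a * g a) (a : A) : marg w X a = v a := by
  classical
  have := h fun b => if b = a then 1 else 0
  simpa [marg] using this

/-- Expanding `negMulLog (m c * k c a)` as a product gives two terms, the first of which sums to the
entropy of `Z`. No positivity is needed. -/
theorem cent_eq_sum_kernel (w : Ω → ℝ) (X : Ω → A) (Z : Ω → C) (m : C → ℝ) (k : C → A → ℝ)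
    (hk : ∀ c, ∑ a, k c a = 1)
    (h : ∀ a c, marg w (fun ω => (X ω, Z ω)) (a, c) = m c * k c a) :
    cent w X Z = ∑ c, m c * ∑ a, negMulLog (k c a) := by
  have hZ : ∀ c, marg w Z c = m c := fun c => by
    rw [← sum_marg_prod w X Z c]
    simp [h, ← Finset.mul_sum, hk]
  simp only [cent, ent, hZ, Fintype.sum_prod_type_right, h, negMulLog_mul,
    Finset.sum_add_distrib, ← Finset.mul_sum, ← Finset.sum_mul, hk]
  ring

end Weights

/-! ### Blocks and a uniformly distributed time index -/

section Blocks

variable {Ω A B C ι : Type*} [Fintype Ω] [Fintype A] [Fintype B] [Fintype C] [Fintype ι]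


/-- The weights `w` together with an independent uniformly distributed index. -/
noncomputable def timeShare (ι : Type*) [Fintype ι] {Ω : Type*} (w : Ω → ℝ) (x : ι × Ω) : ℝ :=
  (Fintype.card ι : ℝ)⁻¹ * w x.2

theorem timeShare_nonneg {Ω : Type*} {w : Ω → ℝ} (hw : ∀ ω, 0 ≤ w ω) (x : ι × Ω) :
    0 ≤ timeShare ι w x :=
  mul_nonneg (by positivity) (hw _)

theorem sum_timeShare_mul (w : Ω → ℝ) (g : ι × Ω → ℝ) :
    ∑ x, timeShare ι w x * g x = (Fintype.card ι : ℝ)⁻¹ * ∑ i, ∑ ω, w ω * g (i, ω) := by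
  simp [timeShare, Fintype.sum_prod_type, Finset.mul_sum, mul_assoc]

theorem card_mul_sum_timeShare_mul [Nonempty ι] (w : Ω → ℝ) (g : ι × Ω → ℝ) :
    (Fintype.card ι : ℝ) * ∑ x, timeShare ι w x * g x = ∑ i, ∑ ω, w ω * g (i, ω) := by
  rw [sum_timeShare_mul, mul_inv_cancel_left₀ (by simp)]

variable [DecidableEq ι]

theorem sum_prod_kernel (k : ι → A → ℝ) :
    ∑ a : ι → A, ∏ i, k i (a i) = ∏ i, ∑ a, k i a := by
  rw [Finset.prod_univ_sum, Fintype.piFinset_univ]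

theorem sum_prod_kernel_eq_one {k : ι → A → ℝ} (hk : ∀ i, ∑ a, k i a = 1) :
    ∑ a : ι → A, ∏ i, k i (a i) = 1 := by
  simp [sum_prod_kernel, hk]

/-- The test function is absorbed into the factor at `i`; every other factor sums to 1. -/
theorem sum_prod_kernel_mul {k : ι → A → ℝ} (hk : ∀ i, ∑ a, k i a = 1) (i : ι) (g : A → ℝ) :
    ∑ a : ι → A, (∏ j, k j (a j)) * g (a i) = ∑ a, k i a * g a := by
  have h : ∀ a : ι → A, (∏ j, k j (a j)) * g (a i) =
      ∏ j, (k j (a j) * if j = i then g (a j) else 1) := fun a => by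
    rw [Finset.prod_mul_distrib]
    simp
  simp only [h]
  rw [sum_prod_kernel fun j b => k j b * if j = i then g b else 1,
    Finset.prod_eq_single i]
  · simp
  · intro j _ hj
    simp [hj, hk]
  · simp

theorem sum_log_prod {ι : Type*} [Fintype ι] {w : Ω → ℝ} (hw : ∀ ω, 0 ≤ w ω) (g : ι → Ω → ℝ)
    (hg : ∀ ω, 0 < w ω → ∀ i, g i ω ≠ 0) :
    ∑ ω, w ω * log (∏ i, g i ω) = ∑ i, ∑ ω, w ω * log (g i ω) := by
  rw [Finset.sum_comm]
  refine Finset.sum_congr rfl fun ω _ => ?_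
  rcases (hw ω).eq_or_lt with h0 | h0
  · simp [← h0]
  · rw [log_prod fun i _ => hg ω h0 i, Finset.mul_sum]

/-- Subadditivity of conditional entropy together with its concavity. -/
theorem cent_block_le [Nonempty ι] {w : Ω → ℝ} (hw : ∀ ω, 0 ≤ w ω) (X : ι → Ω → A) (T : Ω → C)
    (f : ι → C → B) :
    cent w (fun ω i => X i ω) T ≤
      Fintype.card ι * cent (timeShare ι w) (fun x => X x.1 x.2) (fun x => f x.1 (T x.2)) := by
  classical
  have hw' := timeShare_nonneg (ι := ι) hw
  -- The competitor is the product over `i` of one and the same kernel, the time-averaged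
  -- conditional law, so a single use of Gibbs' inequality gives subadditivity and concavity
  -- together.
  set q := condLaw (timeShare ι w) (fun x : ι × Ω => X x.1 x.2) (fun x => f x.1 (T x.2)) with hq
  have hpos : ∀ ω, 0 < w ω → ∀ i, 0 < q (X i ω) (f i (T ω)) := fun ω h i =>
    condLaw_pos hw' (fun x : ι × Ω => X x.1 x.2) (fun x => f x.1 (T x.2)) (ω := (i, ω))
      (mul_pos (by simp [Fintype.card_pos]) h)
  have h1 := cent_le_cross hw (fun ω i => X i ω) T (q := fun a c => ∏ i, q (a i) (f i c))
    (fun a c => Finset.prod_nonneg fun i _ => condLaw_nonneg hw' _ _ _ _)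
    (fun c => by
      rw [sum_prod_kernel fun i b => q b (f i c)]
      exact Finset.prod_le_one
        (fun i _ => Finset.sum_nonneg fun a _ => condLaw_nonneg hw' _ _ _ _)
        fun i _ => sum_condLaw_le _ _ _ _)
    (fun ω h => Finset.prod_pos fun i _ => hpos ω h i)
  rw [cent_eq_condLaw hw', mul_neg, card_mul_sum_timeShare_mul]
  rwa [sum_log_prod hw (fun i ω => q (X i ω) (f i (T ω))) fun ω h i => (hpos ω h i).ne'] at h1

/-- For a memoryless block, the conditional entropy is at least the time-shared one. -/
theorem le_cent_block [Nonempty ι] {w : Ω → ℝ} (hw : ∀ ω, 0 ≤ w ω) (X : ι → Ω → A) (T : Ω → C)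
    (f : ι → C → B) {q : A → B → ℝ} (hq : ∀ a b, 0 ≤ q a b) (hq1 : ∀ b, ∑ a, q a b ≤ 1)
    (h : ∀ a t, marg w (fun ω => (fun i => X i ω, T ω)) (a, t) =
      (∏ i, q (a i) (f i t)) * marg w T t) :
    Fintype.card ι * cent (timeShare ι w) (fun x => X x.1 x.2) (fun x => f x.1 (T x.2)) ≤
      cent w (fun ω i => X i ω) T := by
  have hw' := timeShare_nonneg (ι := ι) hw
  have hpos : ∀ ω, 0 < w ω → ∀ i, 0 < q (X i ω) (f i (T ω)) := by
    intro ω h0 i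
    have h1 := marg_pos hw (fun ω => (fun i => X i ω, T ω)) h0
    rw [h] at h1
    refine (hq _ _).lt_of_ne fun h2 => ?_
    rw [Finset.prod_eq_zero (Finset.mem_univ i) h2.symm] at h1
    simp at h1
  -- By memorylessness the block entropy equals the cross entropy of the one-letter kernel `q`,
  -- which dominates the time-shared entropy.
  rw [cent_eq_cross hw (fun ω i => X i ω) T (q := fun a t => ∏ i, q (a i) (f i t)) h,
    sum_log_prod hw (fun i ω => q (X i ω) (f i (T ω))) fun ω h i => (hpos ω h i).ne',
    ← card_mul_sum_timeShare_mul w fun x => log (q (X x.1 x.2) (f x.1 (T x.2))), ← mul_neg]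
  refine mul_le_mul_of_nonneg_left ?_ (by positivity)
  refine cent_le_cross hw' _ _ hq hq1 fun x hx => hpos _ ?_ _
  exact pos_of_mul_pos_right hx (by positivity)

end Blocks

/-! ### Two conditionally independent sources and a channel -/

section SourceChannel

variable {A B C D : Type*} [Fintype A] [Fintype B] [Fintype C] [Fintype D]

/-- The law `m` and the kernels `k₁`, `k₂`, `v` are stochastic. -/
structure IsNet {A B A' B' C D : Type*} [Fintype A] [Fintype B] [Fintype C] [Fintype D]
    (m : C → ℝ) (k₁ : C → A → ℝ) (k₂ : C → B → ℝ) (v : A' → B' → D → ℝ) : Prop where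
  nonneg : ∀ c, 0 ≤ m c
  nonneg₁ : ∀ c a, 0 ≤ k₁ c a
  nonneg₂ : ∀ c b, 0 ≤ k₂ c b
  nonneg_chan : ∀ a b d, 0 ≤ v a b d
  sum : ∑ c, m c = 1
  sum₁ : ∀ c, ∑ a, k₁ c a = 1
  sum₂ : ∀ c, ∑ b, k₂ c b = 1
  sum_chan : ∀ a b, ∑ d, v a b d = 1

/-- The joint law `m(c) k₁(a | c) k₂(b | c) v(d | a, b)`. -/
def netWeight {A B C D : Type*} (m : C → ℝ) (k₁ : C → A → ℝ) (k₂ : C → B → ℝ)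
    (v : A → B → D → ℝ) (x : (C × A × B) × D) : ℝ :=
  m x.1.1 * k₁ x.1.1 x.1.2.1 * k₂ x.1.1 x.1.2.2 * v x.1.2.1 x.1.2.2 x.2

variable {m : C → ℝ} {k₁ : C → A → ℝ} {k₂ : C → B → ℝ} {v : A → B → D → ℝ}

theorem netWeight_nonneg (h : IsNet m k₁ k₂ v) (x) : 0 ≤ netWeight m k₁ k₂ v x :=
  mul_nonneg (mul_nonneg (mul_nonneg (h.nonneg _) (h.nonneg₁ _ _)) (h.nonneg₂ _ _))
    (h.nonneg_chan _ _ _)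

theorem marg_netWeight_source (h : IsNet m k₁ k₂ v) (x : C × A × B) :
    marg (netWeight m k₁ k₂ v) (fun ω => ω.1) x = m x.1 * k₁ x.1 x.2.1 * k₂ x.1 x.2.2 := by
  rw [marg_fst]
  simp [netWeight, ← Finset.mul_sum, h.sum_chan]

theorem marg_netWeight_output (h : IsNet m k₁ k₂ v) (d : D) (x : C × A × B) :
    marg (netWeight m k₁ k₂ v) (fun ω => (ω.2, ω.1)) (d, x) =
      v x.2.1 x.2.2 d * marg (netWeight m k₁ k₂ v) (fun ω => ω.1) x := by
  have := marg_comp_injective (netWeight m k₁ k₂ v) (fun ω => ω)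
    (Prod.swap_injective (α := C × A × B) (β := D)) (x, d)
  simp only [Prod.swap] at this
  rw [this, marg_id, marg_netWeight_source h]
  simp [netWeight, mul_comm]

theorem sum_netWeight_mul (h : IsNet m k₁ k₂ v) (g : C × A × B → ℝ) :
    ∑ ω, netWeight m k₁ k₂ v ω * g ω.1 =
      ∑ c, m c * ∑ a, k₁ c a * ∑ b, k₂ c b * g (c, a, b) := by
  rw [← sum_marg_mul (netWeight m k₁ k₂ v) (fun ω => ω.1) g]
  simp only [marg_netWeight_source h, Fintype.sum_prod_type, Finset.mul_sum, mul_assoc]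

theorem sum_netWeight (h : IsNet m k₁ k₂ v) : ∑ ω, netWeight m k₁ k₂ v ω = 1 := by
  have := sum_netWeight_mul h fun _ => 1
  simpa [h.sum₁, h.sum₂, h.sum] using this

theorem marg_netWeight_center (h : IsNet m k₁ k₂ v) (c : C) :
    marg (netWeight m k₁ k₂ v) (fun ω => ω.1.1) c = m c := by
  refine marg_eq_of_forall (fun g => ?_) c
  rw [sum_netWeight_mul h fun x => g x.1]
  simp [← Finset.sum_mul, h.sum₁, h.sum₂]

theorem marg_netWeight_left (h : IsNet m k₁ k₂ v) (a : A) (c : C) :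
    marg (netWeight m k₁ k₂ v) (fun ω => (ω.1.2.1, ω.1.1)) (a, c) =
      k₁ c a * marg (netWeight m k₁ k₂ v) (fun ω => ω.1.1) c := by
  rw [marg_netWeight_center h]
  refine marg_eq_of_forall (v := fun x : A × C => k₁ x.2 x.1 * m x.2) (fun g => ?_) (a, c)
  rw [sum_netWeight_mul h fun x => g (x.2.1, x.1), Fintype.sum_prod_type_right]
  simp only [← Finset.sum_mul, h.sum₂, one_mul, Finset.mul_sum]
  exact Finset.sum_congr rfl fun c _ => Finset.sum_congr rfl fun a _ => by ring

theorem marg_netWeight_right (h : IsNet m k₁ k₂ v) (b : B) (c : C) :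
    marg (netWeight m k₁ k₂ v) (fun ω => (ω.1.2.2, ω.1.1)) (b, c) =
      k₂ c b * marg (netWeight m k₁ k₂ v) (fun ω => ω.1.1) c := by
  rw [marg_netWeight_center h]
  refine marg_eq_of_forall (v := fun x : B × C => k₂ x.2 x.1 * m x.2) (fun g => ?_) (b, c)
  rw [sum_netWeight_mul h fun x => g (x.2.2, x.1), Fintype.sum_prod_type_right]
  refine Finset.sum_congr rfl fun c _ => ?_
  dsimp only
  rw [← Finset.sum_mul, h.sum₁, one_mul, Finset.mul_sum]
  exact Finset.sum_congr rfl fun b _ => by ring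

/-- Conditional independence of the sources given the centre, in the form that `cent_add_cent_le`
requires. -/
theorem marg_netWeight_pair (h : IsNet m k₁ k₂ v) (a : A) (b : B) (c : C) :
    marg (netWeight m k₁ k₂ v) (fun ω => ((ω.1.2.1, ω.1.2.2), ω.1.1)) ((a, b), c) =
      k₁ c a * k₂ c b * marg (netWeight m k₁ k₂ v) (fun ω => ω.1.1) c := by
  rw [marg_netWeight_center h]
  refine marg_eq_of_forall (v := fun x : (A × B) × C => k₁ x.2 x.1.1 * k₂ x.2 x.1.2 * m x.2)
    (fun g => ?_) ((a, b), c)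
  rw [sum_netWeight_mul h fun x => g ((x.2.1, x.2.2), x.1), Fintype.sum_prod_type_right]
  simp only [Finset.mul_sum, Fintype.sum_prod_type]
  exact Finset.sum_congr rfl fun c _ => Finset.sum_congr rfl fun a _ =>
    Finset.sum_congr rfl fun b _ => by ring

end SourceChannel

/-! ### The single-letter form of a block code -/

section Code

variable {S₁ S₂ X₁ X₂ Y R₁ R₂ Z : Type*} [Fintype S₁] [Fintype S₂] [Fintype Y] [Fintype Z] {n : ℕ}

/-- The joint law of `(Zⁿ, S₁ⁿ, S₂ⁿ, Yⁿ)` for a block code. -/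
noncomputable def codeWeight {S₁ S₂ X₁ X₂ Y R₁ R₂ Z : Type*} {n : ℕ} (m : Z → ℝ) (k₁ : Z → S₁ → ℝ)
    (k₂ : Z → S₂ → ℝ) (v : X₁ → X₂ → Y → ℝ) (c : Code S₁ S₂ X₁ X₂ Y R₁ R₂ n) :
    ((Fin n → Z) × (Fin n → S₁) × (Fin n → S₂)) × (Fin n → Y) → ℝ :=
  netWeight (fun z => ∏ i, m (z i)) (fun z s => ∏ i, k₁ (z i) (s i))
    (fun z s => ∏ i, k₂ (z i) (s i)) fun s₁ s₂ y => ∏ i, v (c.enc₁ s₁ i) (c.enc₂ s₂ i) (y i)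

variable {m : Z → ℝ} {k₁ : Z → S₁ → ℝ} {k₂ : Z → S₂ → ℝ} {v : X₁ → X₂ → Y → ℝ}

/-- A block code is again a network, with centre Zⁿ and the encoders absorbed into the channel, so
the results on `netWeight` serve for blocks as well as for letters. -/
theorem isNet_code (h : IsNet m k₁ k₂ v) (c : Code S₁ S₂ X₁ X₂ Y R₁ R₂ n) :
    IsNet (fun z : Fin n → Z => ∏ i, m (z i)) (fun z (s : Fin n → S₁) => ∏ i, k₁ (z i) (s i))
      (fun z (s : Fin n → S₂) => ∏ i, k₂ (z i) (s i))
      fun s₁ s₂ (y : Fin n → Y) => ∏ i, v (c.enc₁ s₁ i) (c.enc₂ s₂ i) (y i) where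
  nonneg _ := Finset.prod_nonneg fun _ _ => h.nonneg _
  nonneg₁ _ _ := Finset.prod_nonneg fun _ _ => h.nonneg₁ _ _
  nonneg₂ _ _ := Finset.prod_nonneg fun _ _ => h.nonneg₂ _ _
  nonneg_chan _ _ _ := Finset.prod_nonneg fun _ _ => h.nonneg_chan _ _ _
  sum := sum_prod_kernel_eq_one (k := fun _ => m) fun _ => h.sum
  sum₁ z := sum_prod_kernel_eq_one (k := fun i => k₁ (z i)) fun _ => h.sum₁ _
  sum₂ z := sum_prod_kernel_eq_one (k := fun i => k₂ (z i)) fun _ => h.sum₂ _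
  sum_chan s₁ s₂ := sum_prod_kernel_eq_one (k := fun i => v (c.enc₁ s₁ i) (c.enc₂ s₂ i))
    fun _ => h.sum_chan _ _

/-- The law of the pair of sources. -/
def sourceLaw {S₁ S₂ Z : Type*} [Fintype Z] (m : Z → ℝ) (k₁ : Z → S₁ → ℝ) (k₂ : Z → S₂ → ℝ)
    (s : S₁ × S₂) : ℝ :=
  ∑ z, m z * k₁ z s.1 * k₂ z s.2

theorem sum_prod_sourceLaw {S₁ S₂ : Type*} (m : Z → ℝ) (k₁ : Z → S₁ → ℝ) (k₂ : Z → S₂ → ℝ)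
    (s₁ : Fin n → S₁) (s₂ : Fin n → S₂) :
    ∑ z : Fin n → Z, (∏ i, m (z i)) * (∏ i, k₁ (z i) (s₁ i)) * (∏ i, k₂ (z i) (s₂ i)) =
      ∏ i, sourceLaw m k₁ k₂ (s₁ i, s₂ i) := by
  simp only [← Finset.prod_mul_distrib]
  exact sum_prod_kernel fun i z => m z * k₁ z (s₁ i) * k₂ z (s₂ i)

theorem sourceLaw_nonneg (h : IsNet m k₁ k₂ v) (s : S₁ × S₂) : 0 ≤ sourceLaw m k₁ k₂ s :=
  Finset.sum_nonneg fun _ _ => mul_nonneg (mul_nonneg (h.nonneg _) (h.nonneg₁ _ _)) (h.nonneg₂ _ _)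

theorem sum_sourceLaw (h : IsNet m k₁ k₂ v) : ∑ s, sourceLaw m k₁ k₂ s = 1 := by
  simp only [sourceLaw]
  rw [Finset.sum_comm]
  simp only [Fintype.sum_prod_type, ← Finset.mul_sum, h.sum₂, mul_one, h.sum₁, h.sum]

/-- Zⁿ is summed out letter by letter, which leaves i.i.d. source pairs. -/
theorem marg_codeWeight_sources (h : IsNet m k₁ k₂ v) (c : Code S₁ S₂ X₁ X₂ Y R₁ R₂ n)
    (s : Fin n → S₁ × S₂) :
    marg (codeWeight m k₁ k₂ v c) (fun ω i => (ω.1.2.1 i, ω.1.2.2 i)) s =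
      ∏ i, sourceLaw m k₁ k₂ (s i) := by
  refine marg_eq_of_forall (v := fun s : Fin n → S₁ × S₂ => ∏ i, sourceLaw m k₁ k₂ (s i))
    (fun g => ?_) s
  rw [codeWeight, sum_netWeight_mul (isNet_code h c) fun x => g fun i => (x.2.1 i, x.2.2 i),
    ← (Equiv.arrowProdEquivProdArrow (Fin n) (fun _ => S₁) (fun _ => S₂)).symm.sum_comp,
    Fintype.sum_prod_type]
  simp only [Equiv.arrowProdEquivProdArrow, Equiv.coe_fn_symm_mk, ← sum_prod_sourceLaw,
    Finset.mul_sum, Finset.sum_mul]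
  rw [Finset.sum_comm]
  refine Finset.sum_congr rfl fun s₁ _ => ?_
  rw [Finset.sum_comm]
  exact Finset.sum_congr rfl fun s₂ _ => Finset.sum_congr rfl fun z _ => by ring

theorem le_of_card_mul_le [NeZero n] {a b : ℝ} (h : (Fintype.card (Fin n) : ℝ) * a ≤
    (Fintype.card (Fin n) : ℝ) * b) : a ≤ b :=
  le_of_mul_le_mul_left h (by simpa using Nat.pos_of_ne_zero (NeZero.ne n))

/-- Given the source blocks, each output letter has the kernel `v` at the encoded inputs. Both
information bounds use this estimate. -/
theorem channel_cent_le [Fintype X₁] [Fintype X₂] [NeZero n] (h : IsNet m k₁ k₂ v)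
    (c : Code S₁ S₂ X₁ X₂ Y R₁ R₂ n) :
    Fintype.card (Fin n) * cent (timeShare (Fin n) (codeWeight m k₁ k₂ v c)) (fun x => x.2.2 x.1)
      (fun x => (c.enc₁ x.2.1.2.1 x.1, c.enc₂ x.2.1.2.2 x.1)) ≤
    cent (codeWeight m k₁ k₂ v c) (fun ω => ω.2) (fun ω => ω.1) :=
  le_cent_block (netWeight_nonneg (isNet_code h c)) (fun i ω => ω.2 i) (fun ω => ω.1)
    (fun i x => (c.enc₁ x.2.1 i, c.enc₂ x.2.2 i)) (q := fun y x => v x.1 x.2 y)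
    (fun _ _ => h.nonneg_chan _ _ _) (fun _ => (h.sum_chan _ _).le)
    (fun y x => marg_netWeight_output (isNet_code h c) y x)

/-- The block inequality `j` is single-letterized term by term: `a₁`, `a₂` use that the sources are
memoryless given Zⁿ, and `b₁`, `b₂` that reconstructions are functions of Yⁿ. -/
theorem block_cond_info_le [Fintype X₁] [Fintype X₂] [Fintype R₁] [Fintype R₂] [NeZero n]
    (h : IsNet m k₁ k₂ v) (c : Code S₁ S₂ X₁ X₂ Y R₁ R₂ n)
    {w : Fin n × ((Fin n → Z) × (Fin n → S₁) × (Fin n → S₂)) × (Fin n → Y) → ℝ}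
    (hw : w = timeShare (Fin n) (codeWeight m k₁ k₂ v c)) :
    cent w (fun x => x.2.1.2.1 x.1) (fun x => x.2.1.1 x.1) -
        cent w (fun x => x.2.1.2.1 x.1) (fun x => (c.dec₁ x.2.2 x.1, x.2.1.1 x.1)) +
      (cent w (fun x => x.2.1.2.2 x.1) (fun x => x.2.1.1 x.1) -
        cent w (fun x => x.2.1.2.2 x.1) (fun x => (c.dec₂ x.2.2 x.1, x.2.1.1 x.1))) ≤
      cent w (fun x => x.2.2 x.1) (fun x => (x.2.1.1, x.1)) -
        cent w (fun x => x.2.2 x.1)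
          (fun x => (c.enc₁ x.2.1.2.1 x.1, c.enc₂ x.2.1.2.2 x.1)) := by
  subst hw
  have hn := isNet_code h c
  have hw : ∀ x, 0 ≤ codeWeight m k₁ k₂ v c x := netWeight_nonneg hn
  have a₁ := le_cent_block hw (fun i ω => ω.1.2.1 i) (fun ω => ω.1.1) (fun i z => z i)
    (q := fun s z => k₁ z s) (fun _ _ => h.nonneg₁ _ _) (fun _ => (h.sum₁ _).le)
    (fun s z => marg_netWeight_left hn s z)
  have a₂ := le_cent_block hw (fun i ω => ω.1.2.2 i) (fun ω => ω.1.1) (fun i z => z i)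
    (q := fun s z => k₂ z s) (fun _ _ => h.nonneg₂ _ _) (fun _ => (h.sum₂ _).le)
    (fun s z => marg_netWeight_right hn s z)
  have b₁ := cent_block_le hw (fun i ω => ω.1.2.1 i) (fun ω => (ω.2, ω.1.1))
    (fun i x => (c.dec₁ x.1 i, x.2 i))
  have b₂ := cent_block_le hw (fun i ω => ω.1.2.2 i) (fun ω => (ω.2, ω.1.1))
    (fun i x => (c.dec₂ x.1 i, x.2 i))
  -- The whole pair (Zⁿ, I) is kept as the condition; it is the time-sharing variable Q.
  have c₁ := cent_block_le hw (fun i ω => ω.2 i) (fun ω => ω.1.1) (fun i z => (z, i))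
  have e₁ := channel_cent_le h c
  have i₁ := cent_add_cent_le hw (fun ω => ω.1.2.1) (fun ω => ω.1.2.2) (fun ω => ω.1.1)
    (q₁ := fun s z => ∏ i, k₁ (z i) (s i)) (q₂ := fun s z => ∏ i, k₂ (z i) (s i))
    (fun _ _ => hn.nonneg₁ _ _) (fun _ _ => hn.nonneg₂ _ _) (fun _ => (hn.sum₁ _).le)
    (fun _ => (hn.sum₂ _).le) (fun s₁ s₂ z => marg_netWeight_pair hn s₁ s₂ z)
  have j := condInfo_add_le hw (fun ω => ω.1.2.1) (fun ω => ω.1.2.2) (fun ω => ω.2)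
    (fun ω => ω.1.1) i₁
  refine le_of_card_mul_le (n := n) ?_
  simp only [mul_add, mul_sub]
  linarith

theorem sum_timeShare [NeZero n] {Ω : Type*} [Fintype Ω] {w : Ω → ℝ} (hw : ∑ ω, w ω = 1) :
    ∑ x, timeShare (Fin n) w x = 1 := by
  have := sum_timeShare_mul (ι := Fin n) w fun _ => 1
  simp only [mul_one, hw] at this
  simpa using this

/-- The unconditional analogue, obtained by conditioning on the constant `()`. -/
theorem block_info_le [Fintype X₁] [Fintype X₂] [Fintype R₁] [Fintype R₂] [NeZero n]
    (h : IsNet m k₁ k₂ v) (c : Code S₁ S₂ X₁ X₂ Y R₁ R₂ n)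
    {w : Fin n × ((Fin n → Z) × (Fin n → S₁) × (Fin n → S₂)) × (Fin n → Y) → ℝ}
    (hw : w = timeShare (Fin n) (codeWeight m k₁ k₂ v c)) :
    ent w (fun x => (x.2.1.2.1 x.1, x.2.1.2.2 x.1)) -
        cent w (fun x => (x.2.1.2.1 x.1, x.2.1.2.2 x.1))
          (fun x => (c.dec₁ x.2.2 x.1, c.dec₂ x.2.2 x.1)) ≤
      ent w (fun x => x.2.2 x.1) -
        cent w (fun x => x.2.2 x.1)
          (fun x => (c.enc₁ x.2.1.2.1 x.1, c.enc₂ x.2.1.2.2 x.1)) := by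
  subst hw
  have hn := isNet_code h c
  have hw : ∀ x, 0 ≤ codeWeight m k₁ k₂ v c x := netWeight_nonneg hn
  have hs : ∑ x, codeWeight m k₁ k₂ v c x = 1 := sum_netWeight hn
  have a := le_cent_block hw (fun i ω => (ω.1.2.1 i, ω.1.2.2 i)) (fun _ => ()) (fun _ _ => ())
    (q := fun s _ => sourceLaw m k₁ k₂ s) (fun _ _ => sourceLaw_nonneg h _)
    (fun _ => (sum_sourceLaw h).le) (fun s t => by
      have e := marg_comp_injective (codeWeight m k₁ k₂ v c)
        (fun ω i => (ω.1.2.1 i, ω.1.2.2 i)) (Prod.mk_left_injective ()) s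
      rw [e, marg_codeWeight_sources h c]
      simp [marg, hs])
  have b := cent_block_le hw (fun i ω => (ω.1.2.1 i, ω.1.2.2 i)) (fun ω => ω.2)
    (fun i y => (c.dec₁ y i, c.dec₂ y i))
  have c₁ := cent_block_le hw (fun i ω => ω.2 i) (fun _ => ()) (fun _ _ => ())
  have e₁ := channel_cent_le h c
  -- Adding Zⁿ to the condition can only lower H(Yⁿ|S₁ⁿ,S₂ⁿ), so that `e₁` applies here too.
  have j := cent_le_cent_comp hw (fun ω => ω.2) (fun ω => ω.1) (fun x i => (x.2.1 i, x.2.2 i))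
  have l := ent_sub_cent_comm (codeWeight m k₁ k₂ v c) (fun ω i => (ω.1.2.1 i, ω.1.2.2 i))
    (fun ω => ω.2)
  rw [cent_unit hs, cent_unit (sum_timeShare hs)] at a c₁
  refine le_of_card_mul_le (n := n) ?_
  simp only [mul_sub]
  linarith

end Code

/-! ### Time sharing over a multiple access channel -/

section TimeSharing

variable {A B C D : Type*} [Fintype A] [Fintype B] [Fintype C] [Fintype D]

/-- The entropy of the output of the channel `v` for the input law `P`. -/
noncomputable def outEnt {A B D : Type*} [Fintype A] [Fintype B] [Fintype D] (v : A → B → D → ℝ)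
    (P : A × B → ℝ) : ℝ :=
  ∑ d, negMulLog (∑ x, P x * v x.1 x.2 d)

/-- The conditional entropy of the output of the channel `v` given its inputs of law `P`. -/
noncomputable def chanEnt {A B D : Type*} [Fintype A] [Fintype B] [Fintype D] (v : A → B → D → ℝ)
    (P : A × B → ℝ) : ℝ :=
  ∑ x, P x * ∑ d, negMulLog (v x.1 x.2 d)

/-- The output entropy for independent inputs, averaged over the time-sharing variable. -/
noncomputable def shareEnt {A B C D : Type*} [Fintype A] [Fintype B] [Fintype C] [Fintype D]
    (u : C → ℝ) (k₁ : C → A → ℝ) (k₂ : C → B → ℝ) (v : A → B → D → ℝ) : ℝ :=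
  ∑ c, u c * outEnt v fun x => k₁ c x.1 * k₂ c x.2

variable {u : C → ℝ} {k₁ : C → A → ℝ} {k₂ : C → B → ℝ} {v : A → B → D → ℝ}

theorem sum_netWeight_mul_all (u : C → ℝ) (k₁ : C → A → ℝ) (k₂ : C → B → ℝ) (v : A → B → D → ℝ)
    (g : (C × A × B) × D → ℝ) :
    ∑ ω, netWeight u k₁ k₂ v ω * g ω =
      ∑ c, u c * ∑ a, k₁ c a * ∑ b, k₂ c b * ∑ d, v a b d * g ((c, a, b), d) := by
  simp only [netWeight, Fintype.sum_prod_type, Finset.mul_sum, mul_assoc]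

theorem cent_netWeight_center (h : IsNet u k₁ k₂ v) :
    cent (netWeight u k₁ k₂ v) (fun ω => ω.2) (fun ω => ω.1.1) = shareEnt u k₁ k₂ v := by
  refine cent_eq_sum_kernel _ _ _ u (fun c d => ∑ x : A × B, k₁ c x.1 * k₂ c x.2 * v x.1 x.2 d)
    (fun c => ?_) fun d c => ?_
  · rw [Finset.sum_comm]
    simp only [← Finset.mul_sum, h.sum_chan, mul_one, Fintype.sum_prod_type, h.sum₂, h.sum₁]
  · refine marg_eq_of_forall (v := fun x : D × C =>
      u x.2 * ∑ y : A × B, k₁ x.2 y.1 * k₂ x.2 y.2 * v y.1 y.2 x.1) (fun g => ?_) (d, c)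
    rw [sum_netWeight_mul_all u k₁ k₂ v fun ω => g (ω.2, ω.1.1), Fintype.sum_prod_type_right]
    refine Finset.sum_congr rfl fun c _ => ?_
    simp only [Fintype.sum_prod_type, Finset.mul_sum, Finset.sum_mul]
    symm
    rw [Finset.sum_comm]
    refine Finset.sum_congr rfl fun a _ => ?_
    rw [Finset.sum_comm]
    exact Finset.sum_congr rfl fun b _ => Finset.sum_congr rfl fun d _ => by ring

theorem marg_netWeight_output_inputs (u : C → ℝ) (k₁ : C → A → ℝ) (k₂ : C → B → ℝ)
    (v : A → B → D → ℝ) (d : D) (x : A × B) :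
    marg (netWeight u k₁ k₂ v) (fun ω => (ω.2, ω.1.2)) (d, x) =
      sourceLaw u k₁ k₂ x * v x.1 x.2 d := by
  refine marg_eq_of_forall (v := fun y : D × A × B => sourceLaw u k₁ k₂ y.2 * v y.2.1 y.2.2 y.1)
    (fun g => ?_) (d, x)
  rw [sum_netWeight_mul_all u k₁ k₂ v fun ω => g (ω.2, ω.1.2), Fintype.sum_prod_type_right]
  simp only [Fintype.sum_prod_type, sourceLaw, Finset.mul_sum, Finset.sum_mul]
  rw [Finset.sum_comm]
  refine Finset.sum_congr rfl fun a _ => ?_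
  rw [Finset.sum_comm]
  refine Finset.sum_congr rfl fun b _ => ?_
  rw [Finset.sum_comm]
  exact Finset.sum_congr rfl fun d _ => Finset.sum_congr rfl fun c _ => by ring

/-- Given both inputs the output ignores the centre, so this entropy depends on the network only
through the input law and survives a change of Q that preserves it. -/
theorem cent_netWeight_inputs (h : IsNet u k₁ k₂ v) :
    cent (netWeight u k₁ k₂ v) (fun ω => ω.2) (fun ω => ω.1.2) =
      chanEnt v (sourceLaw u k₁ k₂) :=
  cent_eq_sum_kernel _ _ _ (sourceLaw u k₁ k₂) (fun x d => v x.1 x.2 d)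
    (fun _ => h.sum_chan _ _) (marg_netWeight_output_inputs u k₁ k₂ v)

theorem ent_netWeight_output (u : C → ℝ) (k₁ : C → A → ℝ) (k₂ : C → B → ℝ)
    (v : A → B → D → ℝ) :
    ent (netWeight u k₁ k₂ v) (fun ω => ω.2) = outEnt v (sourceLaw u k₁ k₂) := by
  refine Finset.sum_congr rfl fun d _ => ?_
  have e := marg_comp_injective (netWeight u k₁ k₂ v) (fun ω => (ω.2, ω.1.2))
    (Equiv.prodComm D (A × B)).injective
  rw [← sum_marg_prod (netWeight u k₁ k₂ v) (fun ω => ω.1.2) (fun ω => ω.2) d]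
  congr 1
  refine Finset.sum_congr rfl fun x _ => ?_
  rw [← marg_netWeight_output_inputs u k₁ k₂ v, ← e]
  rfl

end TimeSharing
-- Carathéodory's theorem and a time-sharing variable of bounded size
theorem sum_extend_zero {ι κ M : Type*} [Fintype ι] [Fintype κ] [AddCommMonoid M] (e : ι ↪ κ)
    (f : ι → M) : ∑ j, Function.extend e f 0 j = ∑ i, f i := by
  refine (Finset.sum_of_injOn e e.injective.injOn (by simp) (fun j _ hj => ?_)
    fun i _ => (e.injective.extend_apply f 0 i).symm).symm
  rw [Function.extend_apply' _ _ _ (by simpa using hj)]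
  rfl

/-- **Carathéodory's theorem** with a fixed number of points. -/
theorem exists_fin_of_mem_convexHull {E : Type*} [AddCommGroup E] [Module ℝ E]
    [FiniteDimensional ℝ E] {s : Set E} {x : E} (hx : x ∈ convexHull ℝ s) :
    ∃ (u : Fin (Module.finrank ℝ E + 1) → ℝ) (z : Fin (Module.finrank ℝ E + 1) → E),
      u ∈ stdSimplex ℝ (Fin (Module.finrank ℝ E + 1)) ∧ (∀ i, z i ∈ s) ∧ ∑ i, u i • z i = x := by
  classical
  obtain ⟨ι, _, z, w, hz, hai, hw, hw1, rfl⟩ := eq_pos_convex_span_of_mem_convexHull hx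
  have hcard : Fintype.card ι ≤ Fintype.card (Fin (Module.finrank ℝ E + 1)) := by
    rw [Fintype.card_fin]
    exact hai.card_le_finrank_succ.trans
      (Nat.succ_le_succ (Submodule.finrank_le _))
  obtain ⟨e⟩ := Function.Embedding.nonempty_of_card_le hcard
  obtain ⟨y, hy⟩ : s.Nonempty := convexHull_nonempty_iff.1 ⟨_, hx⟩
  -- The number of points must not depend on `x`: missing points are filled by an arbitrary `y` in
  -- `s`, with weight 0.
  refine ⟨Function.extend e w 0, Function.extend e z fun _ => y, ⟨fun j => ?_, ?_⟩,
    fun j => ?_, ?_⟩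
  · by_cases hj : ∃ i, e i = j
    · obtain ⟨i, rfl⟩ := hj
      rw [e.injective.extend_apply]
      exact (hw i).le
    · rw [Function.extend_apply' _ _ _ hj]
      rfl
  · rw [sum_extend_zero, hw1]
  · by_cases hj : ∃ i, e i = j
    · obtain ⟨i, rfl⟩ := hj
      rw [e.injective.extend_apply]
      exact hz ⟨i, rfl⟩
    · rw [Function.extend_apply' _ _ _ hj]
      exact hy
  · rw [← sum_extend_zero e fun i => w i • z i]
    refine Finset.sum_congr rfl fun j _ => ?_
    by_cases hj : ∃ i, e i = j
    · obtain ⟨i, rfl⟩ := hj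
      simp only [e.injective.extend_apply]
    · simp [Function.extend_apply' _ _ _ hj]

/-- A time-sharing variable of bounded size suffices. -/
theorem exists_fin_share {A B C D : Type*} [Fintype A] [Fintype B] [Fintype C] [Fintype D]
    {u : C → ℝ} {k₁ : C → A → ℝ} {k₂ : C → B → ℝ} {v : A → B → D → ℝ} (h : IsNet u k₁ k₂ v) :
    ∃ (u' : Fin (Module.finrank ℝ ((A × B → ℝ) × ℝ) + 1) → ℝ)
      (k₁' : Fin (Module.finrank ℝ ((A × B → ℝ) × ℝ) + 1) → A → ℝ)
      (k₂' : Fin (Module.finrank ℝ ((A × B → ℝ) × ℝ) + 1) → B → ℝ),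
      IsNet u' k₁' k₂' v ∧ sourceLaw u' k₁' k₂' = sourceLaw u k₁ k₂ ∧
        shareEnt u' k₁' k₂' v = shareEnt u k₁ k₂ v := by
  -- The mean of `F` over the time-sharing variable is the pair (input law, H(Y|Q)), and
  -- Carathéodory's theorem preserves it with dimension + 1 values of Q.
  let F : (A → ℝ) × (B → ℝ) → (A × B → ℝ) × ℝ := fun p =>
    (fun x => p.1 x.1 * p.2 x.2, outEnt v fun x => p.1 x.1 * p.2 x.2)
  have hx : (∑ c, u c • F (k₁ c, k₂ c)) ∈
      convexHull ℝ (F '' (stdSimplex ℝ A ×ˢ stdSimplex ℝ B)) :=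
    mem_convexHull_of_exists_fintype u _ h.nonneg h.sum
      (fun c => ⟨_, ⟨⟨h.nonneg₁ c, h.sum₁ c⟩, ⟨h.nonneg₂ c, h.sum₂ c⟩⟩, rfl⟩) rfl
  obtain ⟨u', z, hu', hz, hsum⟩ := exists_fin_of_mem_convexHull hx
  choose p hp hpz using hz
  simp only [← hpz] at hsum
  refine ⟨u', fun i => (p i).1, fun i => (p i).2, ⟨hu'.1, fun i => (hp i).1.1, fun i => (hp i).2.1,
    h.nonneg_chan, hu'.2, fun i => (hp i).1.2, fun i => (hp i).2.2, h.sum_chan⟩, ?_, ?_⟩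
  · funext x
    have := congrFun (congrArg Prod.fst hsum) x
    simpa [F, sourceLaw, Prod.fst_sum, Finset.sum_apply, mul_assoc] using this
  · have := congrArg Prod.snd hsum
    simpa [F, shareEnt, Prod.snd_sum] using this

/-! ### The laws induced by a block code -/

section CodeLaws

variable {S₁ S₂ X₁ X₂ Y R₁ R₂ Z : Type*} [Fintype S₁] [Fintype S₂] [Fintype Y] [Fintype Z] {n : ℕ}
  {m : Z → ℝ} {k₁ : Z → S₁ → ℝ} {k₂ : Z → S₂ → ℝ} {v : X₁ → X₂ → Y → ℝ}

/-- The law of the time-sharing variable `(Zⁿ, I)`. -/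
noncomputable def shareLaw {Z : Type*} {n : ℕ} (m : Z → ℝ) (q : (Fin n → Z) × Fin n) : ℝ :=
  (n : ℝ)⁻¹ * ∏ i, m (q.1 i)

/-- The conditional law of a channel input given the time-sharing variable `(Zⁿ, I)`. -/
noncomputable def inputKernel {S X Z : Type*} [Fintype S] {n : ℕ} (k : Z → S → ℝ)
    (e : (Fin n → S) → Fin n → X) (q : (Fin n → Z) × Fin n) : X → ℝ :=
  marg (fun s : Fin n → S => ∏ i, k (q.1 i) (s i)) fun s => e s q.2

theorem isNet_share [Fintype X₁] [Fintype X₂] [NeZero n] (h : IsNet m k₁ k₂ v)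
    (c : Code S₁ S₂ X₁ X₂ Y R₁ R₂ n) :
    IsNet (shareLaw (n := n) m) (inputKernel k₁ c.enc₁) (inputKernel k₂ c.enc₂) v where
  nonneg _ := mul_nonneg (by positivity) (Finset.prod_nonneg fun _ _ => h.nonneg _)
  nonneg₁ _ _ := marg_nonneg (fun _ => Finset.prod_nonneg fun _ _ => h.nonneg₁ _ _) _ _
  nonneg₂ _ _ := marg_nonneg (fun _ => Finset.prod_nonneg fun _ _ => h.nonneg₂ _ _) _ _
  nonneg_chan := h.nonneg_chan
  sum := by
    simp only [shareLaw, ← Finset.mul_sum, Fintype.sum_prod_type_right]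
    rw [(isNet_code h c).sum]
    simp [NeZero.ne n]
  sum₁ q := (sum_marg _ _).trans ((isNet_code h c).sum₁ q.1)
  sum₂ q := (sum_marg _ _).trans ((isNet_code h c).sum₂ q.1)
  sum_chan := h.sum_chan

/-- Given Zⁿ the source blocks are independent and each encoder reads only its own, so the inputs at
time I are independent given (Zⁿ, I). Output letters at other times sum out. -/
theorem marg_timeShare_channel [Fintype X₁] [Fintype X₂] (h : IsNet m k₁ k₂ v)
    (c : Code S₁ S₂ X₁ X₂ Y R₁ R₂ n) :
    marg (timeShare (Fin n) (codeWeight m k₁ k₂ v c))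
        (fun x => (((x.2.1.1, x.1), c.enc₁ x.2.1.2.1 x.1, c.enc₂ x.2.1.2.2 x.1), x.2.2 x.1)) =
      netWeight (shareLaw m) (inputKernel k₁ c.enc₁) (inputKernel k₂ c.enc₂) v := by
  funext x
  refine marg_eq_of_forall (fun g => ?_) x
  rw [sum_timeShare_mul _ fun x : Fin n × ((Fin n → Z) × (Fin n → S₁) × (Fin n → S₂)) ×
    (Fin n → Y) => g (((x.2.1.1, x.1), c.enc₁ x.2.1.2.1 x.1, c.enc₂ x.2.1.2.2 x.1), x.2.2 x.1),
    sum_netWeight_mul_all, Fintype.sum_prod_type_right, Finset.mul_sum]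
  refine Finset.sum_congr rfl fun i _ => ?_
  rw [codeWeight, sum_netWeight_mul_all _ _ _ _ fun ω : ((Fin n → Z) × (Fin n → S₁) ×
    (Fin n → S₂)) × (Fin n → Y) =>
      g (((ω.1.1, i), c.enc₁ ω.1.2.1 i, c.enc₂ ω.1.2.2 i), ω.2 i), Finset.mul_sum]
  refine Finset.sum_congr rfl fun z _ => ?_
  rw [shareLaw, Fintype.card_fin, mul_assoc, inputKernel, sum_marg_mul]
  congr 2
  refine Finset.sum_congr rfl fun s₁ _ => ?_
  rw [inputKernel, sum_marg_mul]
  congr 1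
  refine Finset.sum_congr rfl fun s₂ _ => ?_
  congr 1
  exact sum_prod_kernel_mul (k := fun i => v (c.enc₁ s₁ i) (c.enc₂ s₂ i))
    (fun _ => h.sum_chan _ _) i
    fun y => g (((z, i), c.enc₁ s₁ i, c.enc₂ s₂ i), y)

/-- The triples (Zᵢ, S₁ᵢ, S₂ᵢ) all have the same law, so averaging over the index changes nothing.
-/
theorem sum_timeShare_source [NeZero n] (h : IsNet m k₁ k₂ v) (c : Code S₁ S₂ X₁ X₂ Y R₁ R₂ n)
    (g : Z → S₁ → S₂ → ℝ) :
    ∑ x, timeShare (Fin n) (codeWeight m k₁ k₂ v c) x *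
        g (x.2.1.1 x.1) (x.2.1.2.1 x.1) (x.2.1.2.2 x.1) =
      ∑ z, m z * ∑ s₁, k₁ z s₁ * ∑ s₂, k₂ z s₂ * g z s₁ s₂ := by
  have key : ∀ i : Fin n, ∑ ω, codeWeight m k₁ k₂ v c ω * g (ω.1.1 i) (ω.1.2.1 i) (ω.1.2.2 i) =
      ∑ z, m z * ∑ s₁, k₁ z s₁ * ∑ s₂, k₂ z s₂ * g z s₁ s₂ := by
    intro i
    rw [codeWeight, sum_netWeight_mul (isNet_code h c) fun x => g (x.1 i) (x.2.1 i) (x.2.2 i),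
      ← sum_prod_kernel_mul (k := fun _ : Fin n => m) (fun _ => h.sum) i]
    refine Finset.sum_congr rfl fun z _ => ?_
    congr 1
    rw [← sum_prod_kernel_mul (k := fun j => k₁ (z j)) (fun _ => h.sum₁ _) i]
    refine Finset.sum_congr rfl fun s₁ _ => ?_
    congr 1
    rw [← sum_prod_kernel_mul (k := fun j => k₂ (z j)) (fun _ => h.sum₂ _) i]
  rw [sum_timeShare_mul _ fun x : Fin n × ((Fin n → Z) × (Fin n → S₁) × (Fin n → S₂)) ×
    (Fin n → Y) => g (x.2.1.1 x.1) (x.2.1.2.1 x.1) (x.2.1.2.2 x.1)]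
  simp [key, NeZero.ne n]

/-- Summing out Zⁿ recovers the block law of the source, hence the distortions in the definition of
achievability. -/
theorem sum_codeWeight_mul (c : Code S₁ S₂ X₁ X₂ Y R₁ R₂ n)
    (g : (Fin n → S₁) → (Fin n → S₂) → (Fin n → Y) → ℝ) :
    ∑ ω, codeWeight m k₁ k₂ v c ω * g ω.1.2.1 ω.1.2.2 ω.2 =
      ∑ s₁, ∑ s₂, ∑ y, (∏ i, sourceLaw m k₁ k₂ (s₁ i, s₂ i)) *
        (∏ i, v (c.enc₁ s₁ i) (c.enc₂ s₂ i) (y i)) * g s₁ s₂ y := by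
  rw [codeWeight, sum_netWeight_mul_all _ _ _ _ fun ω : ((Fin n → Z) × (Fin n → S₁) ×
    (Fin n → S₂)) × (Fin n → Y) => g ω.1.2.1 ω.1.2.2 ω.2]
  simp only [← sum_prod_sourceLaw, Finset.mul_sum, Finset.sum_mul]
  rw [Finset.sum_comm]
  refine Finset.sum_congr rfl fun s₁ _ => ?_
  rw [Finset.sum_comm]
  refine Finset.sum_congr rfl fun s₂ _ => ?_
  rw [Finset.sum_comm]
  exact Finset.sum_congr rfl fun y _ => Finset.sum_congr rfl fun z _ => by ring

end CodeLaws

/-! ### Single-letter quantities of a code, and their compactness -/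

/-- `I(S; U | Z)` for `((S, Z), U)` of law `t`. -/
noncomputable def condInfo {A B C : Type*} [Fintype A] [Fintype B] [Fintype C]
    (t : (A × C) × B → ℝ) : ℝ :=
  cent t (fun ω => ω.1.1) (fun ω => ω.1.2) - cent t (fun ω => ω.1.1) (fun ω => (ω.2, ω.1.2))

/-- `I(S; U)` for `(S, U)` of law `t`. -/
noncomputable def info {A B : Type*} [Fintype A] [Fintype B] (t : A × B → ℝ) : ℝ :=
  ent t (fun ω => ω.1) - cent t (fun ω => ω.1) (fun ω => ω.2)

section Continuity

variable {Θ Ω A C : Type*} [TopologicalSpace Θ] [Fintype Ω] [Fintype A] [Fintype C]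

theorem continuous_marg {A : Type*} {f : Θ → Ω → ℝ} (hf : Continuous f) (X : Ω → A) :
    Continuous fun θ => marg (f θ) X := by
  classical
  refine continuous_pi fun a => continuous_finsetSum _ fun ω _ => ?_
  split_ifs
  · exact (continuous_apply ω).comp hf
  · exact continuous_const

theorem continuous_ent {f : Θ → Ω → ℝ} (hf : Continuous f) (X : Ω → A) :
    Continuous fun θ => ent (f θ) X :=
  continuous_finsetSum _ fun a _ =>
    continuous_negMulLog.comp ((continuous_apply a).comp (continuous_marg hf X))

theorem continuous_cent {f : Θ → Ω → ℝ} (hf : Continuous f) (X : Ω → A) (Z : Ω → C) :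
    Continuous fun θ => cent (f θ) X Z :=
  (continuous_ent hf _).sub (continuous_ent hf _)

theorem continuous_outEnt {A B D : Type*} [Fintype A] [Fintype B] [Fintype D] (v : A → B → D → ℝ) :
    Continuous (outEnt v) :=
  continuous_finsetSum _ fun d _ => continuous_negMulLog.comp (by fun_prop)

theorem continuous_chanEnt {A B D : Type*} [Fintype A] [Fintype B] [Fintype D]
    (v : A → B → D → ℝ) : Continuous (chanEnt v) := by
  unfold chanEnt
  fun_prop

end Continuity

theorem marg_mem_stdSimplex {Ω A : Type*} [Fintype Ω] [Fintype A] {w : Ω → ℝ}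
    (hw : w ∈ stdSimplex ℝ Ω) (X : Ω → A) : marg w X ∈ stdSimplex ℝ A :=
  ⟨marg_nonneg hw.1 X, (sum_marg w X).trans hw.2⟩

section Feasible

variable {S₁ S₂ X₁ X₂ Y Z : Type*} [Fintype S₁] [Fintype S₂] [Fintype X₁] [Fintype X₂]
  [Fintype Y] [Fintype Z]

/-- The laws of `((S₁, Z), Ŝ₁)`, `((S₂, Z), Ŝ₂)` and `((S₁, S₂), Ŝ₁, Ŝ₂)`, and the laws of `Q` and
of the channel inputs given `Q`, that satisfy the two single-letter inequalities. -/
def feasible {S₁ S₂ X₁ X₂ Y Z : Type*} [Fintype S₁] [Fintype S₂] [Fintype X₁] [Fintype X₂]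
    [Fintype Y] [Fintype Z] (R₁ R₂ Q : Type*) [Fintype R₁] [Fintype R₂] [Fintype Q]
    (m : Z → ℝ) (k₁ : Z → S₁ → ℝ) (k₂ : Z → S₂ → ℝ) (v : X₁ → X₂ → Y → ℝ) :
    Set (((S₁ × Z) × R₁ → ℝ) × ((S₂ × Z) × R₂ → ℝ) × ((S₁ × S₂) × R₁ × R₂ → ℝ) ×
      (Q → ℝ) × (Q → X₁ → ℝ) × (Q → X₂ → ℝ)) :=
  (stdSimplex ℝ _ ×ˢ stdSimplex ℝ _ ×ˢ stdSimplex ℝ _ ×ˢ stdSimplex ℝ _ ×ˢ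
    Set.univ.pi (fun _ => stdSimplex ℝ X₁) ×ˢ Set.univ.pi (fun _ => stdSimplex ℝ X₂)) ∩
  {θ | marg θ.1 (fun ω => ω.1) = (fun x => m x.2 * k₁ x.2 x.1) ∧
    marg θ.2.1 (fun ω => ω.1) = (fun x => m x.2 * k₂ x.2 x.1) ∧
    marg θ.2.2.1 (fun ω => ω.1) = sourceLaw m k₁ k₂ ∧
    condInfo θ.1 + condInfo θ.2.1 ≤ shareEnt θ.2.2.2.1 θ.2.2.2.2.1 θ.2.2.2.2.2 v -
      chanEnt v (sourceLaw θ.2.2.2.1 θ.2.2.2.2.1 θ.2.2.2.2.2) ∧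
    info θ.2.2.1 ≤ outEnt v (sourceLaw θ.2.2.2.1 θ.2.2.2.2.1 θ.2.2.2.2.2) -
      chanEnt v (sourceLaw θ.2.2.2.1 θ.2.2.2.2.1 θ.2.2.2.2.2)}

/-- Closed conditions on a product of simplices. `cent` is a difference of entropies, without
quotients, so it stays continuous where probabilities vanish. -/
theorem isCompact_feasible (R₁ R₂ Q : Type*) [Fintype R₁] [Fintype R₂] [Fintype Q]
    (m : Z → ℝ) (k₁ : Z → S₁ → ℝ) (k₂ : Z → S₂ → ℝ) (v : X₁ → X₂ → Y → ℝ) :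
    IsCompact (feasible R₁ R₂ Q m k₁ k₂ v) := by
  refine IsCompact.inter_right ((isCompact_stdSimplex ℝ _).prod ((isCompact_stdSimplex ℝ _).prod
    ((isCompact_stdSimplex ℝ _).prod ((isCompact_stdSimplex ℝ _).prod
    ((isCompact_univ_pi fun _ => isCompact_stdSimplex ℝ _).prod
    (isCompact_univ_pi fun _ => isCompact_stdSimplex ℝ _)))))) ?_
  have hP : Continuous fun θ : ((S₁ × Z) × R₁ → ℝ) × ((S₂ × Z) × R₂ → ℝ) ×
      ((S₁ × S₂) × R₁ × R₂ → ℝ) × (Q → ℝ) × (Q → X₁ → ℝ) × (Q → X₂ → ℝ) =>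
      sourceLaw θ.2.2.2.1 θ.2.2.2.2.1 θ.2.2.2.2.2 := by
    unfold sourceLaw
    fun_prop
  refine (isClosed_eq (continuous_marg (by fun_prop) _) continuous_const).and <|
    (isClosed_eq (continuous_marg (by fun_prop) _) continuous_const).and <|
    (isClosed_eq (continuous_marg (by fun_prop) _) continuous_const).and <|
    (isClosed_le ?_ ?_).and (isClosed_le ?_ ?_)
  · exact ((continuous_cent (by fun_prop) _ _).sub (continuous_cent (by fun_prop) _ _)).add
      ((continuous_cent (by fun_prop) _ _).sub (continuous_cent (by fun_prop) _ _))
  · refine Continuous.sub ?_ ((continuous_chanEnt v).comp hP)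
    refine continuous_finsetSum _ fun q _ => Continuous.mul (by fun_prop) ?_
    exact (continuous_outEnt v).comp (by fun_prop)
  · exact (continuous_ent (by fun_prop) _).sub (continuous_cent (by fun_prop) _ _)
  · exact ((continuous_outEnt v).comp hP).sub ((continuous_chanEnt v).comp hP)

/-- Every block code yields single-letter laws with the same distortions. -/
theorem exists_mem_feasible {R₁ R₂ : Type*} [Fintype R₁] [Fintype R₂] {n : ℕ} [NeZero n]
    {m : Z → ℝ} {k₁ : Z → S₁ → ℝ} {k₂ : Z → S₂ → ℝ} {v : X₁ → X₂ → Y → ℝ} (h : IsNet m k₁ k₂ v)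
    (c : Code S₁ S₂ X₁ X₂ Y R₁ R₂ n) (d₁ : S₁ → R₁ → ℝ) (d₂ : S₂ → R₂ → ℝ) :
    ∃ θ ∈ feasible R₁ R₂ (Fin (Module.finrank ℝ ((X₁ × X₂ → ℝ) × ℝ) + 1)) m k₁ k₂ v,
      (∑ x, θ.1 x * d₁ x.1.1 x.2 = (1 / (n : ℝ)) * ∑ i, ∑ s₁, ∑ s₂, ∑ y,
        (∏ i, sourceLaw m k₁ k₂ (s₁ i, s₂ i)) * (∏ i, v (c.enc₁ s₁ i) (c.enc₂ s₂ i) (y i)) *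
          d₁ (s₁ i) (c.dec₁ y i)) ∧
      (∑ x, θ.2.1 x * d₂ x.1.1 x.2 = (1 / (n : ℝ)) * ∑ i, ∑ s₁, ∑ s₂, ∑ y,
        (∏ i, sourceLaw m k₁ k₂ (s₁ i, s₂ i)) * (∏ i, v (c.enc₁ s₁ i) (c.enc₂ s₂ i) (y i)) *
          d₂ (s₂ i) (c.dec₂ y i)) ∧
      ∑ x, θ.2.2.1 x * d₁ x.1.1 x.2.1 = ∑ x, θ.1 x * d₁ x.1.1 x.2 ∧
      ∑ x, θ.2.2.1 x * d₂ x.1.2 x.2.2 = ∑ x, θ.2.1 x * d₂ x.1.1 x.2 := by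
  -- The variable (Zⁿ, I) is exchanged for one whose alphabet does not depend on `n`.
  obtain ⟨u', p₁, p₂, hnet, hlaw, hent⟩ := exists_fin_share (isNet_share h c)
  set w := timeShare (Fin n) (codeWeight m k₁ k₂ v c) with hw
  have hws : w ∈ stdSimplex ℝ _ := ⟨timeShare_nonneg (netWeight_nonneg (isNet_code h c)),
    sum_timeShare (sum_netWeight (isNet_code h c))⟩
  have hch := marg_timeShare_channel h c
  have hsh := isNet_share h c
  rw [← hw] at hch
  have e₁ := cent_netWeight_center hsh
  have e₂ := cent_netWeight_inputs hsh
  have e₃ := ent_netWeight_output (shareLaw m) (inputKernel k₁ c.enc₁) (inputKernel k₂ c.enc₂) v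
  rw [← hch, cent_marg] at e₁ e₂
  rw [← hch, ent_marg] at e₃
  have i₁ := block_cond_info_le h c hw
  have i₂ := block_info_le h c hw
  have hdist : ∀ g : (Fin n → S₁) → (Fin n → S₂) → (Fin n → Y) → Fin n → ℝ,
      ∑ x, w x * g x.2.1.2.1 x.2.1.2.2 x.2.2 x.1 = (1 / (n : ℝ)) * ∑ i, ∑ s₁, ∑ s₂, ∑ y,
        (∏ i, sourceLaw m k₁ k₂ (s₁ i, s₂ i)) * (∏ i, v (c.enc₁ s₁ i) (c.enc₂ s₂ i) (y i)) *
          g s₁ s₂ y i := by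
    intro g
    rw [hw, sum_timeShare_mul _ fun x : Fin n × ((Fin n → Z) × (Fin n → S₁) × (Fin n → S₂)) ×
      (Fin n → Y) => g x.2.1.2.1 x.2.1.2.2 x.2.2 x.1, Fintype.card_fin, one_div]
    congr 1
    exact Finset.sum_congr rfl fun i _ => sum_codeWeight_mul c fun s₁ s₂ y => g s₁ s₂ y i
  -- All three source laws are marginals of the same `w`, which is why their distortions agree.
  refine ⟨(marg w fun x => ((x.2.1.2.1 x.1, x.2.1.1 x.1), c.dec₁ x.2.2 x.1),
    marg w fun x => ((x.2.1.2.2 x.1, x.2.1.1 x.1), c.dec₂ x.2.2 x.1),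
    marg w fun x => ((x.2.1.2.1 x.1, x.2.1.2.2 x.1), c.dec₁ x.2.2 x.1, c.dec₂ x.2.2 x.1),
    u', p₁, p₂), ⟨⟨marg_mem_stdSimplex hws _, marg_mem_stdSimplex hws _,
      marg_mem_stdSimplex hws _, ⟨hnet.nonneg, hnet.sum⟩,
      fun q _ => ⟨hnet.nonneg₁ q, hnet.sum₁ q⟩, fun q _ => ⟨hnet.nonneg₂ q, hnet.sum₂ q⟩⟩,
      ?_, ?_, ?_, ?_, ?_⟩, ?_, ?_, ?_, ?_⟩
  · funext x
    rw [marg_marg]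
    refine marg_eq_of_forall (v := fun x : S₁ × Z => m x.2 * k₁ x.2 x.1) (fun g => ?_) x
    rw [hw, sum_timeShare_source h c fun z s₁ _ => g (s₁, z), Fintype.sum_prod_type_right]
    simp only [← Finset.sum_mul, h.sum₂, one_mul, Finset.mul_sum, mul_assoc]
  · funext x
    rw [marg_marg]
    refine marg_eq_of_forall (v := fun x : S₂ × Z => m x.2 * k₂ x.2 x.1) (fun g => ?_) x
    rw [hw, sum_timeShare_source h c fun z _ s₂ => g (s₂, z), Fintype.sum_prod_type_right]
    refine Finset.sum_congr rfl fun z _ => ?_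
    simp only [← Finset.sum_mul, h.sum₁, one_mul]
    simp only [Finset.mul_sum, mul_assoc]
  · funext x
    rw [marg_marg]
    refine marg_eq_of_forall (fun g => ?_) x
    rw [hw, sum_timeShare_source h c fun z s₁ s₂ => g (s₁, s₂)]
    simp only [sourceLaw, Finset.sum_mul, Finset.mul_sum, Fintype.sum_prod_type]
    rw [Finset.sum_comm]
    refine Finset.sum_congr rfl fun s₁ _ => ?_
    rw [Finset.sum_comm]
    simp only [mul_assoc]
  · simp only [condInfo, cent_marg, hlaw, hent, ← e₁, ← e₂]
    exact i₁
  · simp only [info, cent_marg, ent_marg, hlaw, ← e₂, ← e₃]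
    exact i₂
  · simp only [sum_marg_mul _ _ fun x : (S₁ × Z) × R₁ => d₁ x.1.1 x.2]
    exact hdist fun s₁ _ y i => d₁ (s₁ i) (c.dec₁ y i)
  · simp only [sum_marg_mul _ _ fun x : (S₂ × Z) × R₂ => d₂ x.1.1 x.2]
    exact hdist fun _ s₂ y i => d₂ (s₂ i) (c.dec₂ y i)
  · simp only [sum_marg_mul _ _ fun x : (S₁ × Z) × R₁ => d₁ x.1.1 x.2,
      sum_marg_mul _ _ fun x : (S₁ × S₂) × R₁ × R₂ => d₁ x.1.1 x.2.1]
  · simp only [sum_marg_mul _ _ fun x : (S₂ × Z) × R₂ => d₂ x.1.1 x.2,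
      sum_marg_mul _ _ fun x : (S₁ × S₂) × R₁ × R₂ => d₂ x.1.2 x.2.2]

end Feasible

/-! ### Probability mass functions and real weights -/

section PMF

variable {Ω A B C : Type*} [Fintype Ω] [Fintype A] [Fintype B] [Fintype C]

/-- The probabilities of the elementary events, as real numbers. -/
noncomputable def weight {Ω : Type*} (P : PMF Ω) (ω : Ω) : ℝ := (P ω).toReal

theorem weight_nonneg {Ω : Type*} (P : PMF Ω) (ω : Ω) : 0 ≤ weight P ω := ENNReal.toReal_nonneg

theorem sum_weight (P : PMF Ω) : ∑ ω, weight P ω = 1 := by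
  have h := P.tsum_coe
  rw [tsum_fintype] at h
  simp only [weight]
  rw [← ENNReal.toReal_sum fun ω _ => P.apply_ne_top ω, h, ENNReal.toReal_one]

theorem weight_map {A : Type*} (P : PMF Ω) (X : Ω → A) : weight (P.map X) = marg (weight P) X := by
  classical
  funext a
  rw [weight, PMF.map_apply, tsum_fintype, ENNReal.toReal_sum]
  · refine Finset.sum_congr rfl fun ω _ => ?_
    by_cases h : X ω = a
    · simp [h, weight]
    · simp [h, Ne.symm h]
  · intro ω _
    split_ifs
    · exact P.apply_ne_top ω
    · simp

theorem prob_eq_marg {A : Type*} (P : PMF Ω) (X : Ω → A) (a : A) :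
    prob P X a = marg (weight P) X a :=
  congrFun (weight_map P X) a

theorem entropy_eq_ent (P : PMF Ω) (X : Ω → A) : entropy P X = ent (weight P) X := by
  simp [entropy, ent, prob_eq_marg, negMulLog]

theorem condEntropy_eq_cent (P : PMF Ω) (X : Ω → A) (Z : Ω → C) :
    condEntropy P X Z = cent (weight P) X Z := by
  rw [cent_eq_condLaw (weight_nonneg P), ← sum_marg_mul (weight P) (fun ω => (X ω, Z ω))
    fun x => log (condLaw (weight P) X Z x.1 x.2)]
  simp [condEntropy, prob_eq_marg, condLaw, Fintype.sum_prod_type]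

theorem mutualInfo_eq (P : PMF Ω) (X : Ω → A) (Y : Ω → B) :
    mutualInfo P X Y = ent (weight P) X - cent (weight P) X Y := by
  rw [mutualInfo, entropy_eq_ent, condEntropy_eq_cent]

theorem condMutualInfo_eq (P : PMF Ω) (X : Ω → A) (Y : Ω → B) (Z : Ω → C) :
    condMutualInfo P X Y Z = cent (weight P) X Z - cent (weight P) X (fun ω => (Y ω, Z ω)) := by
  rw [condMutualInfo, condEntropy_eq_cent, condEntropy_eq_cent]

theorem weight_joint {A B : Type*} (p : PMF A) (κ : A → PMF B) (x : A × B) :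
    weight (joint p κ) x = weight p x.1 * weight (κ x.1) x.2 := by
  classical
  obtain ⟨a, b⟩ := x
  have h : ∀ a', ((κ a').map fun b => (a', b)) (a, b) = if a = a' then κ a b else 0 := by
    intro a'
    rw [PMF.map_apply]
    by_cases h : a = a'
    · subst h
      simp
    · simp [h]
  simp [weight, joint, PMF.bind_apply, h]

theorem exists_pmf_weight {w : Ω → ℝ} (hw : w ∈ stdSimplex ℝ Ω) : ∃ P : PMF Ω, weight P = w := by
  refine ⟨PMF.ofFintype (fun ω => ENNReal.ofReal (w ω)) ?_, ?_⟩
  · rw [← ENNReal.ofReal_sum_of_nonneg fun ω _ => hw.1 ω, hw.2, ENNReal.ofReal_one]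
  · funext ω
    simp [weight, hw.1 ω]

/-- Disintegration of a joint law. -/
theorem exists_weight_joint_eq (p : PMF A) {t : A × B → ℝ} (ht : t ∈ stdSimplex ℝ (A × B))
    (hp : marg t (fun ω => ω.1) = weight p) : ∃ κ : A → PMF B, weight (joint p κ) = t := by
  have key : ∀ a, ∃ μ : PMF B, ∀ b, weight p a * weight μ b = t (a, b) := by
    intro a
    have hsum : ∑ b, t (a, b) = weight p a := by rw [← marg_fst, hp]
    rcases eq_or_ne (weight p a) 0 with h | h
    -- Where `p` has no mass any law will do.
    · obtain ⟨μ, -⟩ := exists_pmf_weight (marg_mem_stdSimplex ht fun ω => ω.2)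
      refine ⟨μ, fun b => ?_⟩
      rw [h, Finset.sum_eq_zero_iff_of_nonneg fun _ _ => ht.1 _] at hsum
      rw [h, zero_mul, hsum b (Finset.mem_univ _)]
    · obtain ⟨μ, hμ⟩ := exists_pmf_weight (w := fun b => t (a, b) / weight p a)
        ⟨fun b => div_nonneg (ht.1 _) (weight_nonneg _ _), by
          rw [← Finset.sum_div, hsum, div_self h]⟩
      refine ⟨μ, fun b => ?_⟩
      rw [hμ, mul_div_cancel₀ _ h]
  choose κ hκ using key
  refine ⟨κ, funext fun x => ?_⟩
  rw [weight_joint, hκ]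

/-- The reconstruction itself serves as U, relabelled by `Fin` as the definition demands; the
estimator undoes the relabelling and ignores Z. -/
theorem condRateDistortion_le {A' : Type*} [Fintype A'] (p : PMF (A × C)) (d : A → A' → ℝ) (D : ℝ)
    {t : (A × C) × A' → ℝ} (ht : t ∈ stdSimplex ℝ _) (hp : marg t (fun ω => ω.1) = weight p)
    (hd : ∑ x, t x * d x.1.1 x.2 ≤ D) :
    condRateDistortion p d D ≤ (condInfo t : ℝ) := by
  classical
  let e := Fintype.equivFin A'
  obtain ⟨κ, hκ⟩ := exists_weight_joint_eq p (marg_mem_stdSimplex ht fun ω => (ω.1, e ω.2))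
    (by funext x; rw [marg_marg, ← hp])
  refine iInf_le_of_le _ (iInf_le_of_le κ (iInf_le_of_le ?_ ?_))
  · refine iInf_le_of_le (fun x => e.symm x.1) ?_
    rw [EReal.coe_le_coe_iff]
    change ∑ ω, weight (joint p κ) ω * _ ≤ D
    rw [hκ, sum_marg_mul _ _ fun ω : (A × C) × Fin _ => d ω.1.1 (e.symm ω.2)]
    simpa using hd
  · rw [EReal.coe_le_coe_iff, condMutualInfo_eq, hκ, cent_marg, cent_marg, condInfo]
    have h₁ := ent_comp_injective t (fun ω => (ω.2, ω.1.2)) (e := fun x => (e x.1, x.2))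
      fun x y h => by simpa [Prod.ext_iff] using h
    have h₂ := ent_comp_injective t (fun ω => (ω.1.1, ω.2, ω.1.2))
      (e := fun x => (x.1, e x.2.1, x.2.2))
      fun x y h => by simpa [Prod.ext_iff] using h
    simp only [cent, h₁, h₂, le_refl]

theorem jointRateDistortion_le {R₁ R₂ : Type*} [Fintype R₁] [Fintype R₂] (p : PMF (A × B))
    (d₁ : A → R₁ → ℝ) (d₂ : B → R₂ → ℝ) (D₁ D₂ : ℝ) {t : (A × B) × R₁ × R₂ → ℝ}
    (ht : t ∈ stdSimplex ℝ _) (hp : marg t (fun ω => ω.1) = weight p)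
    (h₁ : ∑ x, t x * d₁ x.1.1 x.2.1 ≤ D₁) (h₂ : ∑ x, t x * d₂ x.1.2 x.2.2 ≤ D₂) :
    jointRateDistortion p d₁ d₂ D₁ D₂ ≤ (info t : ℝ) := by
  obtain ⟨κ, rfl⟩ := exists_weight_joint_eq p ht hp
  refine iInf_le_of_le κ (iInf_le_of_le h₁ (iInf_le_of_le h₂ ?_))
  rw [mutualInfo_eq, info]

/-- A version of the conditional law that is stochastic everywhere. -/
theorem exists_stochastic_condLaw {C : Type*} {w : Ω → ℝ} (hw : w ∈ stdSimplex ℝ Ω)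
    (X : Ω → A) (Z : Ω → C) (c : C) : ∃ k ∈ stdSimplex ℝ A,
      ∀ a, marg w (fun ω => (X ω, Z ω)) (a, c) = marg w Z c * k a := by
  rcases eq_or_ne (marg w Z c) 0 with h | h
  -- Where `Z` has no mass, the law of `X` is a stochastic filler.
  · refine ⟨_, marg_mem_stdSimplex hw X, fun a => ?_⟩
    rw [marg_prod_eq_condLaw_mul hw.1, h, mul_zero, zero_mul]
  · refine ⟨fun a => condLaw w X Z a c, ⟨fun a => condLaw_nonneg hw.1 _ _ _ _, ?_⟩, fun a => ?_⟩
    · simp only [condLaw, ← Finset.sum_div, sum_marg_prod, div_self h]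
    · rw [marg_prod_eq_condLaw_mul hw.1, mul_comm]

/-- A Markov chain is given by a law and two kernels. -/
theorem exists_kernels_of_isMarkovChain (r : PMF (A × B × C))
    (h : IsMarkovChain r (fun ω => ω.1) (fun ω => ω.2.2) (fun ω => ω.2.1)) :
    ∃ (m : C → ℝ) (k₁ : C → A → ℝ) (k₂ : C → B → ℝ),
      m ∈ stdSimplex ℝ C ∧ (∀ c, k₁ c ∈ stdSimplex ℝ A) ∧ (∀ c, k₂ c ∈ stdSimplex ℝ B) ∧
      weight (r.map fun ω => (ω.1, ω.2.2)) = (fun x => m x.2 * k₁ x.2 x.1) ∧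
      weight (r.map fun ω => (ω.2.1, ω.2.2)) = (fun x => m x.2 * k₂ x.2 x.1) ∧
      weight (r.map fun ω => (ω.1, ω.2.1)) = sourceLaw m k₁ k₂ := by
  classical
  have hr : weight r ∈ stdSimplex ℝ _ := ⟨weight_nonneg r, sum_weight r⟩
  choose k₁ hk₁ e₁ using exists_stochastic_condLaw hr (fun ω => ω.1) (fun ω => ω.2.2)
  choose k₂ hk₂ e₂ using exists_stochastic_condLaw hr (fun ω => ω.2.1) (fun ω => ω.2.2)
  set m := marg (weight r) (fun ω => ω.2.2) with hm
  -- Where `m c` is nonzero the Markov identity is divided by it; elsewhere both sides vanish.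
  have e : ∀ ω, weight r ω = m ω.2.2 * k₁ ω.2.2 ω.1 * k₂ ω.2.2 ω.2.1 := by
    rintro ⟨a, b, c⟩
    rcases eq_or_ne (m c) 0 with h0 | h0
    · have := (weight_nonneg r (a, b, c)).eq_or_lt.resolve_right fun h1 =>
        (marg_pos (weight_nonneg r) (fun ω => ω.2.2) h1).ne' h0
      simp [← this, h0]
    · have h1 := h a c b
      have h2 := marg_comp_injective (weight r) (fun ω => ω) (e := fun x => (x.1, x.2.2, x.2.1))
        (fun x y h => by simp only [Prod.mk.injEq] at h; ext <;> simp [h]) (a, b, c)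
      have h3 := marg_comp_injective (weight r) (fun ω => (ω.2.1, ω.2.2))
        (Equiv.prodComm B C).injective (b, c)
      simp only [Equiv.prodComm_apply, Prod.swap_prod_mk] at h3
      simp only [prob_eq_marg] at h1
      rw [h2, h3, marg_id, e₁, e₂, ← hm] at h1
      refine mul_right_cancel₀ h0 (h1.trans ?_)
      ring
  refine ⟨m, k₁, k₂, marg_mem_stdSimplex hr _, hk₁, hk₂, ?_, ?_, ?_⟩
  · rw [weight_map]
    exact funext fun x => e₁ x.2 x.1
  · rw [weight_map]
    exact funext fun x => e₂ x.2 x.1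
  · rw [weight_map]
    funext x
    refine marg_eq_of_forall (fun g => ?_) x
    simp only [e, sourceLaw, Fintype.sum_prod_type, Finset.sum_mul]

/-- A time-shared pair of independent channel inputs, as a probability mass function. -/
theorem exists_input_pmf {D : Type*} [Fintype D] (W : A → B → PMF D) {u : C → ℝ} {k₁ : C → A → ℝ}
    {k₂ : C → B → ℝ} (h : IsNet u k₁ k₂ fun a b => weight (W a b)) :
    ∃ r : PMF (A × B × C),
      IsMarkovChain r (fun ω => ω.1) (fun ω => ω.2.2) (fun ω => ω.2.1) ∧
      shareEnt u k₁ k₂ (fun a b => weight (W a b)) -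
          chanEnt (fun a b => weight (W a b)) (sourceLaw u k₁ k₂) ≤
        condMutualInfo (joint r fun ω => W ω.1 ω.2.1)
          (fun ω => (ω.1.1, ω.1.2.1)) (fun ω => ω.2) (fun ω => ω.1.2.2) ∧
      outEnt (fun a b => weight (W a b)) (sourceLaw u k₁ k₂) -
          chanEnt (fun a b => weight (W a b)) (sourceLaw u k₁ k₂) =
        mutualInfo (joint r fun ω => W ω.1 ω.2.1) (fun ω => (ω.1.1, ω.1.2.1)) (fun ω => ω.2) := by
  set N := netWeight u k₁ k₂ fun a b => weight (W a b) with hN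
  have hNs : N ∈ stdSimplex ℝ _ := ⟨netWeight_nonneg h, sum_netWeight h⟩
  obtain ⟨r, hr⟩ := exists_pmf_weight
    (marg_mem_stdSimplex hNs fun ω => (ω.1.2.1, ω.1.2.2, ω.1.1))
  have hinj : Function.Injective fun x : C × A × B => (x.2.1, x.2.2, x.1) := fun x y h => by
    simp only [Prod.mk.injEq] at h
    ext <;> simp [h]
  have hrx : ∀ a b c, weight r (a, b, c) = u c * k₁ c a * k₂ c b := fun a b c => by
    rw [hr]
    have := marg_comp_injective N (fun ω => ω.1) hinj (c, a, b)
    rw [marg_netWeight_source h] at this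
    exact this
  have hj : weight (joint r fun ω => W ω.1 ω.2.1) =
      marg N fun ω => ((ω.1.2.1, ω.1.2.2, ω.1.1), ω.2) := by
    funext ⟨⟨a, b, c⟩, d⟩
    have := marg_comp_injective N (fun ω => ω) (e := fun x => ((x.1.2.1, x.1.2.2, x.1.1), x.2))
      (fun x y h => by simp only [Prod.mk.injEq] at h; ext <;> simp [h]) ((c, a, b), d)
    rw [marg_id] at this
    rw [weight_joint, hrx]
    exact this.symm
  refine ⟨r, fun a c b => ?_, ?_, ?_⟩
  · have h₁ := marg_comp_injective N (fun ω => ((ω.1.2.1, ω.1.2.2), ω.1.1))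
      (e := fun x => (x.1.1, x.2, x.1.2))
      (fun x y h => by simp only [Prod.mk.injEq] at h; ext <;> simp [h]) ((a, b), c)
    have h₂ := marg_comp_injective N (fun ω => (ω.1.2.2, ω.1.1))
      (Equiv.prodComm B C).injective (b, c)
    simp only [Equiv.prodComm_apply, Prod.swap_prod_mk] at h₂
    simp only [prob_eq_marg, hr, marg_marg]
    rw [h₁, h₂, marg_netWeight_pair h, marg_netWeight_left h, marg_netWeight_right h]
    ring
  · rw [condMutualInfo_eq, cent_sub_cent_comm, hj, cent_marg, cent_marg,
      ← cent_netWeight_center h, ← cent_netWeight_inputs h]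
    -- H(Y|X₁,X₂,Q) ≤ H(Y|X₁,X₂) suffices, although equality holds for a channel.
    exact sub_le_sub_left (cent_le_cent_comp hNs.1 (fun ω => ω.2)
      (fun ω => ((ω.1.2.1, ω.1.2.2), ω.1.1)) fun x => x.1) _
  · rw [mutualInfo_eq, ent_sub_cent_comm, hj, cent_marg, ent_marg, ← cent_netWeight_inputs h,
      ← ent_netWeight_output]

end PMF

end MAC

/-- `r` is the joint law of `(S₁, S₂, Z)`, `r'` that of `(X₁, X₂, Q)`, and
`MAC.joint r' W` that of `((X₁, X₂, Q), Y)`. -/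
theorem mainTheorem10 {S₁ S₂ X₁ X₂ Y R₁ R₂ Z : Type*}
    [Fintype S₁] [Fintype S₂] [Fintype X₁] [Fintype X₂] [Fintype Y] [Fintype R₁] [Fintype R₂]
    [Fintype Z]
    (p : PMF (S₁ × S₂)) (W : X₁ → X₂ → PMF Y)
    (d₁ : S₁ → R₁ → ℝ) (d₂ : S₂ → R₂ → ℝ) (D₁ D₂ : ℝ)
    (hach : MAC.Achievable p W d₁ d₂ D₁ D₂)
    (r : PMF (S₁ × S₂ × Z)) (hr : r.map (fun ω => (ω.1, ω.2.1)) = p)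
    (hZ : MAC.IsMarkovChain r (fun ω => ω.1) (fun ω => ω.2.2) (fun ω => ω.2.1)) :
    ∃ (m : ℕ) (r' : PMF (X₁ × X₂ × Fin m)),
      MAC.IsMarkovChain r' (fun ω => ω.1) (fun ω => ω.2.2) (fun ω => ω.2.1) ∧
      MAC.condRateDistortion (r.map fun ω => (ω.1, ω.2.2)) d₁ D₁ +
          MAC.condRateDistortion (r.map fun ω => (ω.2.1, ω.2.2)) d₂ D₂ ≤
        ((MAC.condMutualInfo (MAC.joint r' fun ω => W ω.1 ω.2.1)
          (fun ω => (ω.1.1, ω.1.2.1)) (fun ω => ω.2) (fun ω => ω.1.2.2) : ℝ) : EReal) ∧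
      MAC.jointRateDistortion p d₁ d₂ D₁ D₂ ≤
        ((MAC.mutualInfo (MAC.joint r' fun ω => W ω.1 ω.2.1)
          (fun ω => (ω.1.1, ω.1.2.1)) (fun ω => ω.2) : ℝ) : EReal) := by
  obtain ⟨m, k₁, k₂, hm, hk₁, hk₂, e₁, e₂, e₁₂⟩ := MAC.exists_kernels_of_isMarkovChain r hZ
  rw [hr] at e₁₂
  set v : X₁ → X₂ → Y → ℝ := fun x₁ x₂ => MAC.weight (W x₁ x₂) with hv
  have hnet : MAC.IsNet m k₁ k₂ v := ⟨hm.1, fun z => (hk₁ z).1, fun z => (hk₂ z).1,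
    fun _ _ => MAC.weight_nonneg _, hm.2, fun z => (hk₁ z).2, fun z => (hk₂ z).2,
    fun _ _ => MAC.sum_weight _⟩
  let F := MAC.feasible R₁ R₂ (Fin (Module.finrank ℝ ((X₁ × X₂ → ℝ) × ℝ) + 1)) m k₁ k₂ v
  -- The four excess distortions are merged into one continuous objective.
  have hex : ∀ ε : ℝ, 0 < ε → ∃ θ ∈ F, max
      (max (∑ x, θ.1 x * d₁ x.1.1 x.2 - D₁) (∑ x, θ.2.1 x * d₂ x.1.1 x.2 - D₂))
      (max (∑ x, θ.2.2.1 x * d₁ x.1.1 x.2.1 - D₁) (∑ x, θ.2.2.1 x * d₂ x.1.2 x.2.2 - D₂)) ≤ ε := by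
    intro ε hε
    obtain ⟨n, ⟨c, hc₁, hc₂⟩, hn⟩ := ((hach ε hε).and (eventually_gt_atTop 0)).exists
    have : NeZero n := ⟨hn.ne'⟩
    obtain ⟨θ, hθ, h₁, h₂, h₃, h₄⟩ := MAC.exists_mem_feasible hnet c d₁ d₂
    refine ⟨θ, hθ, ?_⟩
    rw [h₃, h₄, max_self]
    have hb : ∀ s₁ s₂ y, (∏ i, MAC.sourceLaw m k₁ k₂ (s₁ i, s₂ i)) *
        (∏ i, v (c.enc₁ s₁ i) (c.enc₂ s₂ i) (y i)) = MAC.blockProb p W c s₁ s₂ y := by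
      intro s₁ s₂ y
      rw [← e₁₂]
      rfl
    simp only [hb] at h₁ h₂
    rw [h₁, h₂]
    exact max_le (sub_le_iff_le_add'.2 hc₁) (sub_le_iff_le_add'.2 hc₂)
  -- Only nonemptiness of the compact set is extracted here.
  obtain ⟨θ₁, hθ₁, -⟩ := hex 1 one_pos
  obtain ⟨θ, ⟨⟨ht₁, ht₂, ht₁₂, hu, hp₁, hp₂⟩, hm₁, hm₂, hm₁₂, hI₁, hI₂⟩, hmin⟩ :=
    (MAC.isCompact_feasible R₁ R₂ (Fin (Module.finrank ℝ ((X₁ × X₂ → ℝ) × ℝ) + 1))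
      m k₁ k₂ v).exists_isMinOn ⟨θ₁, hθ₁⟩ (f := fun θ => max
      (max (∑ x, θ.1 x * d₁ x.1.1 x.2 - D₁) (∑ x, θ.2.1 x * d₂ x.1.1 x.2 - D₂))
      (max (∑ x, θ.2.2.1 x * d₁ x.1.1 x.2.1 - D₁) (∑ x, θ.2.2.1 x * d₂ x.1.2 x.2.2 - D₂)))
      (Continuous.continuousOn (by fun_prop))
  -- The minimum lies below every ε > 0, so at the minimizer no distortion exceeds its bound.
  have hle := le_of_forall_pos_le_add fun ε hε => by
    obtain ⟨θ', hθ', h'⟩ := hex ε hε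
    rw [zero_add]
    exact (hmin hθ').trans h'
  simp only [max_le_iff, sub_nonpos] at hle
  obtain ⟨⟨hd₁, hd₂⟩, hd₃, hd₄⟩ := hle
  obtain ⟨r', hMarkov, hc, hi⟩ := MAC.exists_input_pmf W (u := θ.2.2.2.1) (k₁ := θ.2.2.2.2.1)
    (k₂ := θ.2.2.2.2.2) ⟨hu.1, fun q => (hp₁ q trivial).1, fun q => (hp₂ q trivial).1,
      hnet.nonneg_chan, hu.2, fun q => (hp₁ q trivial).2, fun q => (hp₂ q trivial).2,
      hnet.sum_chan⟩
  refine ⟨_, r', hMarkov, ?_, ?_⟩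
  · refine (add_le_add (MAC.condRateDistortion_le _ d₁ D₁ ht₁ (hm₁.trans e₁.symm) hd₁)
      (MAC.condRateDistortion_le _ d₂ D₂ ht₂ (hm₂.trans e₂.symm) hd₂)).trans ?_
    rw [← EReal.coe_add, EReal.coe_le_coe_iff]
    exact hI₁.trans hc
  · refine (MAC.jointRateDistortion_le p d₁ d₂ D₁ D₂ ht₁₂ (hm₁₂.trans e₁₂.symm) hd₃ hd₄).trans ?_
    rw [EReal.coe_le_coe_iff, ← hi]
    exact hI₂
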